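/- **Proposition 3.2 (Quasi-optimality).** Let $\Omega\subset\mathbb{R}^2$ be an open bounded polygon whose boundary is a simple closed polygonal curve with corners $c_1,\dots,c_m$ and straight edges $\Gamma_i$ connecting $c_i$ and $c_{i+1}$ (with $c_{m+1}=c_1$). Let $\lambda>0$, $q\in\mathbb{N}_0$ and $f\in L^{2(q+1)/(2q+1)}(\Omega)$. Then there is a constant $C>0$, depending only on $\lambda$, $q$, $\Omega$ (with its edges) and $f$, such that the following holds. Let $\mathcal{D}\subseteq\{1,\dots,m\}$ be nonempty, $\Gamma_{\mathcal{D}}=\bigcup_{i\in\mathcal{D}}\Gamma_i$, and let $H^1_{\mathcal{D}}(\Omega)$ be the space of all $v\in H^1(\Omega)$ with $v|_{\Gamma_{\mathcal{D}}}=0$ in the sense of traces. Let $u\in H^1_{\mathcal{D}}(\Omega)$ be the weak solution of $-\Delta u+\lambda u^{2q+1}=f$ in $\Omega$ with homogeneous Dirichlet conditions on $\Gamma_{\mathcal{D}}$ and homogeneous Neumann conditions on the other edges, i.e. $$\int_\Omega\nabla u\cdot\nabla v\,dx+\lambda\int_\Omega u^{2q+1}v\,dx=\int_\Omega fv\,dx\qquad\forall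 v\in H^1_{\mathcal{D}}(\Omega).$$ Let $W_N\subset H^1_{\mathcal{D}}(\Omega)$ be any finite-dimensional subspace, and let $U\in W_N$ be the Galerkin solution, i.e. $$\int_\Omega\nabla U\cdot\nabla v\,dx+\lambda\int_\Omega U^{2q+1}v\,dx=\int_\Omega fv\,dx\qquad\forall v\in W_N.$$ Then $$\|\nabla(u-U)\|_{L^2(\Omega)}\le C\inf_{w\in W_N}\|\nabla(u-w)\|_{L^2(\Omega)}.$$ -/

import Mathlib

open MeasureTheory Filter Topology
open scoped ContDiff ENNReal

noncomputable section

/-- The Euclidean plane `ℝ²`. -/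
abbrev Plane : Type := EuclideanSpace ℝ (Fin 2)

/-- The edge `Γ_i` from the corner `c_i` to the next corner `c_{i+1}`; the addition in `Fin m` is
cyclic, so that the last edge returns to the first corner. -/
def polygonEdge {m : ℕ} [NeZero m] (c : Fin m → Plane) (i : Fin m) : Set Plane :=
  segment ℝ (c i) (c (i + 1))

/-- `Ω` is an open bounded polygon with corners `c_0, …, c_{m-1}`: a bounded connected open set
whose boundary is the simple closed polygonal curve through the corners. Straight angles at corners
are allowed (the type of the boundary condition may change there). -/
structure IsPolygonalDomain {m : ℕ} [NeZero m] (Ω : Set Plane) (c : Fin m → Plane) : Prop where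
  isOpen : IsOpen Ω
  isConnected : IsConnected Ω
  isBounded : Bornology.IsBounded Ω
  three_le : 3 ≤ m
  corners_injective : Function.Injective c
  /-- Two different edges meet at most in a common endpoint. -/
  edges_inter : ∀ i j : Fin m, i ≠ j →
    polygonEdge c i ∩ polygonEdge c j ⊆ {c i, c (i + 1)} ∩ {c j, c (j + 1)}
  frontier_eq : frontier Ω = ⋃ i, polygonEdge c i

/-- Arc-length measure on the segment from `a` to `b`. -/
def arcLengthMeasure (a b : Plane) : Measure Plane :=
  ENNReal.ofReal (dist a b) •
    (volume.restrict (Set.Icc (0 : ℝ) 1)).map (fun t => AffineMap.lineMap a b t)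

/-- Arc-length measure on `Γ_D`, the union of the edges `Γ_i` with `i ∈ D`. -/
def boundaryMeasure {m : ℕ} [NeZero m] (c : Fin m → Plane) (D : Finset (Fin m)) :
    Measure Plane :=
  ∑ i ∈ D, arcLengthMeasure (c i) (c (i + 1))

/-- `g` is the weak gradient of `v` in `Ω`: for every test function `φ ∈ C_c^∞(Ω)` and `i = 0, 1`,
`∫_Ω v ∂_i φ = - ∫_Ω g_i φ`. -/
def IsWeakGradient (Ω : Set Plane) (v : Plane → ℝ) (g : Plane → Plane) : Prop :=
  ∀ φ : Plane → ℝ, ContDiff ℝ ∞ φ → HasCompactSupport φ → tsupport φ ⊆ Ω → ∀ i : Fin 2,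
    ∫ x in Ω, v x * fderiv ℝ φ x (EuclideanSpace.single i 1) = - ∫ x in Ω, g x i * φ x

/-- The Lebesgue space `L²(Ω)`. -/
abbrev L2Scalar (Ω : Set Plane) : Type := Lp ℝ 2 (volume.restrict Ω : Measure Plane)

/-- The Lebesgue space `L²(Ω)²` of square integrable vector fields. -/
abbrev L2Vector (Ω : Set Plane) : Type := Lp Plane 2 (volume.restrict Ω : Measure Plane)

theorem integrable_mul_test {Ω : Set Plane} {v : Plane → ℝ}
    (hv : MemLp v 2 (volume.restrict Ω)) {ψ : Plane → ℝ} (hψ : Continuous ψ)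
    (hc : HasCompactSupport ψ) : Integrable (fun x => v x * ψ x) (volume.restrict Ω) :=
  MemLp.integrable_mul (p := 2) (q := 2) hv (hψ.memLp_of_hasCompactSupport hc)

theorem memLp_coord {Ω : Set Plane} (g : L2Vector Ω) (i : Fin 2) :
    MemLp (fun x => g x i) 2 (volume.restrict Ω) :=
  ContinuousLinearMap.comp_memLp' (EuclideanSpace.proj i : Plane →L[ℝ] ℝ) (Lp.memLp g)

theorem continuous_test_deriv {φ : Plane → ℝ} (hφ : ContDiff ℝ ∞ φ) (e : Plane) :
    Continuous (fun x => fderiv ℝ φ x e) :=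
  (hφ.continuous_fderiv (by simp)).clm_apply continuous_const

/-- The Sobolev space `H¹(Ω)`. A function `v ∈ L²(Ω)` with weak gradient in `L²(Ω)²` is stored
together with this gradient (which `v` determines almost everywhere), as the pair `(v, ∇v)`. -/
def SobolevH1 (Ω : Set Plane) : Submodule ℝ (L2Scalar Ω × L2Vector Ω) where
  carrier := {p | IsWeakGradient Ω p.1 p.2}
  zero_mem' := by
    intro φ _ _ _ i
    have h1 : ∫ x in Ω, (0 : L2Scalar Ω) x * fderiv ℝ φ x (EuclideanSpace.single i 1) = 0 := by
      apply integral_eq_zero_of_ae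
      filter_upwards [Lp.coeFn_zero ℝ 2 (volume.restrict Ω : Measure Plane)] with x hx
      rw [hx]
      simp
    have h2 : ∫ x in Ω, (0 : L2Vector Ω) x i * φ x = 0 := by
      apply integral_eq_zero_of_ae
      filter_upwards [Lp.coeFn_zero Plane 2 (volume.restrict Ω : Measure Plane)] with x hx
      rw [hx]
      simp
    exact h1.trans (by rw [← neg_zero, ← h2]; rfl)
  add_mem' := by
    intro p p' hp hp' φ h1 h2 h3 i
    have hd := continuous_test_deriv h1 (EuclideanSpace.single i 1)
    have hdc : HasCompactSupport (fun x => fderiv ℝ φ x (EuclideanSpace.single i 1)) :=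
      h2.fderiv_apply ℝ _
    have e1 : ∫ x in Ω, (p.1 + p'.1 : L2Scalar Ω) x * fderiv ℝ φ x (EuclideanSpace.single i 1)
        = ∫ x in Ω, (p.1 x * fderiv ℝ φ x (EuclideanSpace.single i 1)
          + p'.1 x * fderiv ℝ φ x (EuclideanSpace.single i 1)) := by
      apply integral_congr_ae
      filter_upwards [Lp.coeFn_add p.1 p'.1] with x hx
      rw [hx, Pi.add_apply, add_mul]
    have e2 : ∫ x in Ω, (p.2 + p'.2 : L2Vector Ω) x i * φ x
        = ∫ x in Ω, (p.2 x i * φ x + p'.2 x i * φ x) := by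
      apply integral_congr_ae
      filter_upwards [Lp.coeFn_add p.2 p'.2] with x hx
      rw [hx, Pi.add_apply, PiLp.add_apply, add_mul]
    change ∫ x in Ω, (p.1 + p'.1 : L2Scalar Ω) x * fderiv ℝ φ x (EuclideanSpace.single i 1)
      = - ∫ x in Ω, (p.2 + p'.2 : L2Vector Ω) x i * φ x
    rw [e1, e2, integral_add (integrable_mul_test (Lp.memLp p.1) hd hdc)
      (integrable_mul_test (Lp.memLp p'.1) hd hdc),
      integral_add (integrable_mul_test (memLp_coord p.2 i) h1.continuous h2)
      (integrable_mul_test (memLp_coord p'.2 i) h1.continuous h2),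
      hp φ h1 h2 h3 i, hp' φ h1 h2 h3 i]
    ring
  smul_mem' := by
    intro r p hp φ h1 h2 h3 i
    have e1 : ∫ x in Ω, (r • p.1 : L2Scalar Ω) x * fderiv ℝ φ x (EuclideanSpace.single i 1)
        = ∫ x in Ω, r * (p.1 x * fderiv ℝ φ x (EuclideanSpace.single i 1)) := by
      apply integral_congr_ae
      filter_upwards [Lp.coeFn_smul r p.1] with x hx
      rw [hx, Pi.smul_apply, smul_eq_mul, mul_assoc]
    have e2 : ∫ x in Ω, (r • p.2 : L2Vector Ω) x i * φ x
        = ∫ x in Ω, r * (p.2 x i * φ x) := by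
      apply integral_congr_ae
      filter_upwards [Lp.coeFn_smul r p.2] with x hx
      rw [hx, Pi.smul_apply, PiLp.smul_apply, smul_eq_mul, mul_assoc]
    change ∫ x in Ω, (r • p.1 : L2Scalar Ω) x * fderiv ℝ φ x (EuclideanSpace.single i 1)
      = - ∫ x in Ω, (r • p.2 : L2Vector Ω) x i * φ x
    rw [e1, e2, integral_const_mul, integral_const_mul, hp φ h1 h2 h3 i]
    ring

/-- The function underlying an element of `H¹(Ω)`. -/
def h1Fun {Ω : Set Plane} (v : SobolevH1 Ω) : L2Scalar Ω := v.1.1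

/-- The weak gradient `∇v` of an element of `H¹(Ω)`. -/
def h1Grad {Ω : Set Plane} (v : SobolevH1 Ω) : L2Vector Ω := v.1.2

/-- `v ∈ H¹(Ω)` has zero trace on `Γ_D`. The trace operator is the continuous extension of
`φ ↦ φ|_{Γ_D}` from functions that are smooth up to the boundary to `H¹(Ω) → L²(Γ_D)`; so the trace
of `v` is zero if and only if there are such `φ_n` with `φ_n → v` in `H¹(Ω)` and
`φ_n|_{Γ_D} → 0` in `L²(Γ_D)`. -/
def HasZeroTrace {m : ℕ} [NeZero m] {Ω : Set Plane} (c : Fin m → Plane) (D : Finset (Fin m))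
    (v : SobolevH1 Ω) : Prop :=
  ∃ φ : ℕ → Plane → ℝ, (∀ n, ContDiff ℝ ∞ (φ n)) ∧
    Tendsto (fun n => eLpNorm (fun x => φ n x - h1Fun v x) 2 (volume.restrict Ω))
      atTop (𝓝 0) ∧
    Tendsto (fun n => eLpNorm (fun x => gradient (φ n) x - h1Grad v x) 2 (volume.restrict Ω))
      atTop (𝓝 0) ∧
    Tendsto (fun n => eLpNorm (φ n) 2 (boundaryMeasure c D)) atTop (𝓝 0)

theorem continuous_gradient_of_contDiff {φ : Plane → ℝ} (hφ : ContDiff ℝ ∞ φ) :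
    Continuous (gradient φ) :=
  (InnerProductSpace.toDual ℝ Plane).symm.continuous.comp (hφ.continuous_fderiv (by simp))

theorem gradient_add_of_contDiff {φ ψ : Plane → ℝ} (hφ : ContDiff ℝ ∞ φ) (hψ : ContDiff ℝ ∞ ψ)
    (x : Plane) : gradient (fun y => φ y + ψ y) x = gradient φ x + gradient ψ x := by
  have h1 := (hφ.differentiable (by simp)) x
  have h2 := (hψ.differentiable (by simp)) x
  unfold gradient
  rw [fderiv_fun_add h1 h2, map_add]

theorem gradient_const_mul_of_contDiff {φ : Plane → ℝ} (hφ : ContDiff ℝ ∞ φ) (r : ℝ)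
    (x : Plane) : gradient (fun y => r * φ y) x = r • gradient φ x := by
  have h1 := (hφ.differentiable (by simp)) x
  unfold gradient
  rw [fderiv_const_mul h1]
  simp

/-- The space `H¹_D(Ω) = {v ∈ H¹(Ω) : v = 0 on Γ_D}`. -/
def SobolevH1D {m : ℕ} [NeZero m] (Ω : Set Plane) (c : Fin m → Plane) (D : Finset (Fin m)) :
    Submodule ℝ (SobolevH1 Ω) where
  carrier := {v | HasZeroTrace c D v}
  zero_mem' := by
    refine ⟨fun _ _ => 0, fun _ => contDiff_const, ?_, ?_, ?_⟩
    · refine tendsto_const_nhds.congr fun n => ?_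
      symm
      refine (eLpNorm_congr_ae (g := 0) ?_).trans eLpNorm_zero
      filter_upwards [Lp.coeFn_zero ℝ 2 (volume.restrict Ω : Measure Plane)] with x hx
      change 0 - (0 : L2Scalar Ω) x = 0
      rw [hx]
      simp
    · refine tendsto_const_nhds.congr fun n => ?_
      symm
      refine (eLpNorm_congr_ae (g := 0) ?_).trans eLpNorm_zero
      filter_upwards [Lp.coeFn_zero Plane 2 (volume.restrict Ω : Measure Plane)] with x hx
      change gradient (fun _ => (0 : ℝ)) x - (0 : L2Vector Ω) x = 0
      rw [hx]
      simp [gradient]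
    · simp
  add_mem' := by
    rintro v w ⟨φ, h1, h2, h3, h4⟩ ⟨ψ, k1, k2, k3, k4⟩
    refine ⟨fun n x => φ n x + ψ n x, fun n => (h1 n).add (k1 n), ?_, ?_, ?_⟩
    · refine tendsto_of_tendsto_of_tendsto_of_le_of_le tendsto_const_nhds
        (by simpa using h2.add k2) (fun _ => zero_le) fun n => ?_
      refine le_trans (le_of_eq ?_) (eLpNorm_add_le
        ((h1 n).continuous.aestronglyMeasurable.sub (Lp.aestronglyMeasurable (h1Fun v)))
        ((k1 n).continuous.aestronglyMeasurable.sub (Lp.aestronglyMeasurable (h1Fun w)))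
        (by norm_num))
      apply eLpNorm_congr_ae
      filter_upwards [Lp.coeFn_add (h1Fun v) (h1Fun w)] with x hx
      change φ n x + ψ n x - ((h1Fun v) + (h1Fun w) : L2Scalar Ω) x = _
      rw [hx]
      simp only [Pi.add_apply]
      ring
    · refine tendsto_of_tendsto_of_tendsto_of_le_of_le tendsto_const_nhds
        (by simpa using h3.add k3) (fun _ => zero_le) fun n => ?_
      refine le_trans (le_of_eq ?_) (eLpNorm_add_le
        ((continuous_gradient_of_contDiff (h1 n)).aestronglyMeasurable.sub
          (Lp.aestronglyMeasurable (h1Grad v)))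
        ((continuous_gradient_of_contDiff (k1 n)).aestronglyMeasurable.sub
          (Lp.aestronglyMeasurable (h1Grad w))) (by norm_num))
      apply eLpNorm_congr_ae
      filter_upwards [Lp.coeFn_add (h1Grad v) (h1Grad w)] with x hx
      change gradient (fun y => φ n y + ψ n y) x - ((h1Grad v) + (h1Grad w) : L2Vector Ω) x = _
      rw [hx, gradient_add_of_contDiff (h1 n) (k1 n)]
      simp only [Pi.add_apply]
      abel
    · refine tendsto_of_tendsto_of_tendsto_of_le_of_le tendsto_const_nhds
        (by simpa using h4.add k4) (fun _ => zero_le) fun n => ?_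
      exact eLpNorm_add_le (h1 n).continuous.aestronglyMeasurable
        (k1 n).continuous.aestronglyMeasurable (by norm_num)
  smul_mem' := by
    rintro r v ⟨φ, h1, h2, h3, h4⟩
    refine ⟨fun n x => r * φ n x, fun n => contDiff_const.mul (h1 n), ?_, ?_, ?_⟩
    · have := ENNReal.Tendsto.const_mul (a := ‖r‖ₑ) h2 (Or.inr (by simp))
      rw [mul_zero] at this
      refine this.congr fun n => ?_
      rw [← eLpNorm_const_smul]
      apply eLpNorm_congr_ae
      filter_upwards [Lp.coeFn_smul r (h1Fun v)] with x hx
      change _ = r * φ n x - (r • (h1Fun v) : L2Scalar Ω) x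
      rw [hx]
      simp only [Pi.smul_apply, smul_eq_mul]
      ring
    · have := ENNReal.Tendsto.const_mul (a := ‖r‖ₑ) h3 (Or.inr (by simp))
      rw [mul_zero] at this
      refine this.congr fun n => ?_
      rw [← eLpNorm_const_smul]
      apply eLpNorm_congr_ae
      filter_upwards [Lp.coeFn_smul r (h1Grad v)] with x hx
      change _ = gradient (fun y => r * φ n y) x - (r • (h1Grad v) : L2Vector Ω) x
      rw [hx, gradient_const_mul_of_contDiff (h1 n)]
      simp only [Pi.smul_apply, smul_sub]
    · have := ENNReal.Tendsto.const_mul (a := ‖r‖ₑ) h4 (Or.inr (by simp))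
      rw [mul_zero] at this
      refine this.congr fun n => ?_
      rw [← eLpNorm_const_smul]
      rfl

/-- The bilinear form `a(v, w) = ∫_Ω ∇v · ∇w`. -/
def formA {Ω : Set Plane} (v w : SobolevH1 Ω) : ℝ :=
  ∫ x in Ω, inner ℝ (h1Grad v x) (h1Grad w x)

/-- The form `b(u; v) = ∫_Ω u^{2q+1} v`. -/
def formB {Ω : Set Plane} (q : ℕ) (u v : SobolevH1 Ω) : ℝ :=
  ∫ x in Ω, h1Fun u x ^ (2 * q + 1) * h1Fun v x

/-- `U ∈ W` solves `a(U, v) + lam b(U; v) = ∫_Ω f v` for all `v ∈ W`. For `W = H¹_D(Ω)` this is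
the weak formulation of the boundary value problem, for a finite-dimensional subspace `W` it is the
Galerkin discretization. -/
def IsGalerkinSolution {Ω : Set Plane} (lam : ℝ) (q : ℕ) (f : Plane → ℝ)
    (W : Submodule ℝ (SobolevH1 Ω)) (U : SobolevH1 Ω) : Prop :=
  U ∈ W ∧ ∀ v ∈ W, formA U v + lam * formB q U v = ∫ x in Ω, f x * h1Fun v x

/-- The energy norm `‖∇v‖_{L²(Ω)}`. -/
def gradNorm {Ω : Set Plane} (v : SobolevH1 Ω) : ℝ := ‖h1Grad v‖

end

/-! Write E = ‖∇(u - U)‖ and η = u - w with w in W. Testing both equations with w - U and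
subtracting removes f, and w - U = (u - U) - η gives E² = (∇(u - U), ∇η) - λ ∫ (u^{2q+1} -
U^{2q+1})(w - U). Odd powers are strongly monotone and locally Lipschitz with the same weight u^{2q}
+ U^{2q}. The monotone part therefore absorbs, by Young's inequality, what the Lipschitz bound
produces (`neg_odd_pow_sub_mul_le`), leaving E² ≤ E ‖∇η‖ + λ(2q+1)² ∫ (u^{2q} + U^{2q}) η²
(`IsGalerkinSolution.sq_gradNorm_le`). Testing with the solution itself bounds u and U in L^{2q+2}
by f and λ alone (`exists_integral_pow_le`), and the Sobolev–Friedrichs inequality bounds η in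
L^{2q+2} by ‖∇η‖. Hence E² ≤ E ‖∇η‖ + A ‖∇η‖², and so E ≤ (1 + A) ‖∇η‖.

Most of the work is Sobolev–Friedrichs on a polygon (`IsPolygonalDomain.exists_sobolev_friedrichs`).
It needs no extension operator. Near each point the boundary lies on two crossing lines, so four
small parallelograms cover a neighbourhood up to a null set, and each lies inside Ω or outside it.
Affine images of unit-square estimates give the embedding on each parallelogram. A trace estimate at
one Dirichlet edge starts a Poincaré inequality that spreads through Ω by connectedness, and
compactness of the closure reduces the cover to a finite one. Smooth approximation and Fatou's lemma
carry the result to H¹_D. -/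

/-! ### Trace, Poincaré and Sobolev inequalities on the unit square -/

section UnitSquare

/-- Lebesgue measure on the open unit interval. -/
noncomputable abbrev unitIntervalMeasure : Measure ℝ := volume.restrict (Set.Ioo 0 1)

/-- The open unit square. -/
def unitSquare : Set (ℝ × ℝ) := Set.Ioo 0 1 ×ˢ Set.Ioo 0 1

instance : IsProbabilityMeasure unitIntervalMeasure := ⟨by simp⟩

theorem measurableSet_unitSquare : MeasurableSet unitSquare :=
  measurableSet_Ioo.prod measurableSet_Ioo

theorem volume_restrict_unitSquare :
    volume.restrict unitSquare = unitIntervalMeasure.prod unitIntervalMeasure := by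
  rw [Measure.prod_restrict]
  rfl

instance : IsProbabilityMeasure (volume.restrict unitSquare) := by
  rw [volume_restrict_unitSquare]
  infer_instance

theorem ENNReal.add_sq_le (a b : ℝ≥0∞) : (a + b) ^ 2 ≤ 2 * (a ^ 2 + b ^ 2) := by
  induction a with
  | top => simp
  | coe a =>
    induction b with
    | top => simp
    | coe b =>
      have h : ((a : ℝ) + b) ^ 2 ≤ 2 * ((a : ℝ) ^ 2 + (b : ℝ) ^ 2) := _root_.add_sq_le
      exact_mod_cast h

theorem sq_lintegral_mul_le {α : Type*} [MeasurableSpace α] (μ : Measure α) {f g : α → ℝ≥0∞}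
    (hf : AEMeasurable f μ) (hg : AEMeasurable g μ) :
    (∫⁻ x, f x * g x ∂μ) ^ 2 ≤ (∫⁻ x, f x ^ 2 ∂μ) * ∫⁻ x, g x ^ 2 ∂μ := by
  have h := ENNReal.lintegral_mul_le_Lp_mul_Lq μ Real.HolderConjugate.two_two hf hg
  simp only [Pi.mul_apply, ENNReal.rpow_two] at h
  calc _ ≤ _ := pow_le_pow_left₀ zero_le h 2
    _ = _ := by
      rw [mul_pow, ← ENNReal.rpow_two, ← ENNReal.rpow_two, ← ENNReal.rpow_mul, ← ENNReal.rpow_mul]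
      norm_num

theorem sq_lintegral_le {α : Type*} [MeasurableSpace α] (μ : Measure α) [IsProbabilityMeasure μ]
    {f : α → ℝ≥0∞} (hf : AEMeasurable f μ) :
    (∫⁻ x, f x ∂μ) ^ 2 ≤ ∫⁻ x, f x ^ 2 ∂μ := by
  simpa using sq_lintegral_mul_le μ hf (aemeasurable_const (b := 1))

theorem enorm_sub_le_lintegral_deriv {g : ℝ → ℝ} (hg : ContDiff ℝ 1 g) {s t : ℝ}
    (hs : s ∈ Set.Icc (0 : ℝ) 1) (ht : t ∈ Set.Icc (0 : ℝ) 1) :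
    ‖g s - g t‖ₑ ≤ ∫⁻ σ, ‖deriv g σ‖ₑ ∂unitIntervalMeasure := by
  wlog h : t ≤ s generalizing s t
  · rw [← neg_sub, enorm_neg]
    exact this ht hs (le_of_not_ge h)
  refine (enorm_sub_le_lintegral_deriv_of_contDiffOn_Icc hg.contDiffOn h).trans ?_
  rw [unitIntervalMeasure, restrict_Ioo_eq_restrict_Icc]
  exact lintegral_mono_set (Set.Icc_subset_Icc ht.1 hs.2)

variable {ψ : ℝ × ℝ → ℝ}

theorem enorm_sub_le_lintegral_fst (hψ : ContDiff ℝ 1 ψ) {s s' : ℝ} (t : ℝ)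
    (hs : s ∈ Set.Icc (0 : ℝ) 1) (hs' : s' ∈ Set.Icc (0 : ℝ) 1) :
    ‖ψ (s, t) - ψ (s', t)‖ₑ ≤ ∫⁻ σ, ‖fderiv ℝ ψ (σ, t)‖ₑ ∂unitIntervalMeasure := by
  have hg : ContDiff ℝ 1 (fun σ => ψ (σ, t)) := hψ.comp (contDiff_id.prodMk contDiff_const)
  refine (enorm_sub_le_lintegral_deriv hg hs hs').trans (lintegral_mono fun σ => ?_)
  have h1 : HasDerivAt (fun σ : ℝ => (σ, t)) ((1 : ℝ), (0 : ℝ)) σ :=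
    (hasDerivAt_id σ).prodMk (hasDerivAt_const σ t)
  have h2 := ((hψ.differentiable (by simp)) (σ, t)).hasFDerivAt.comp_hasDerivAt σ h1
  have h3 : deriv (fun σ => ψ (σ, t)) σ = fderiv ℝ ψ (σ, t) (1, 0) := h2.deriv
  rw [h3]
  refine ((fderiv ℝ ψ (σ, t)).le_opENorm _).trans_eq ?_
  simp [enorm_eq_nnnorm, Prod.nnnorm_def]

theorem enorm_sub_le_lintegral_snd (hψ : ContDiff ℝ 1 ψ) (s : ℝ) {t t' : ℝ}
    (ht : t ∈ Set.Icc (0 : ℝ) 1) (ht' : t' ∈ Set.Icc (0 : ℝ) 1) :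
    ‖ψ (s, t) - ψ (s, t')‖ₑ ≤ ∫⁻ τ, ‖fderiv ℝ ψ (s, τ)‖ₑ ∂unitIntervalMeasure := by
  have hg : ContDiff ℝ 1 (fun τ => ψ (s, τ)) := hψ.comp (contDiff_const.prodMk contDiff_id)
  refine (enorm_sub_le_lintegral_deriv hg ht ht').trans (lintegral_mono fun τ => ?_)
  have h1 : HasDerivAt (fun τ : ℝ => (s, τ)) ((0 : ℝ), (1 : ℝ)) τ :=
    (hasDerivAt_const τ s).prodMk (hasDerivAt_id τ)
  have h2 := ((hψ.differentiable (by simp)) (s, τ)).hasFDerivAt.comp_hasDerivAt τ h1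
  have h3 : deriv (fun τ => ψ (s, τ)) τ = fderiv ℝ ψ (s, τ) (0, 1) := h2.deriv
  rw [h3]
  refine ((fderiv ℝ ψ (s, τ)).le_opENorm _).trans_eq ?_
  simp [enorm_eq_nnnorm, Prod.nnnorm_def]

theorem measurable_enorm_fderiv {E : Type*} [NormedAddCommGroup E] [NormedSpace ℝ E]
    [MeasurableSpace E] [BorelSpace E] {φ : E → ℝ} (hφ : ContDiff ℝ 1 φ) :
    Measurable fun x => ‖fderiv ℝ φ x‖ₑ :=
  (hφ.continuous_fderiv (by simp)).enorm.measurable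

theorem enorm_sub_sq_le_fst (hψ : ContDiff ℝ 1 ψ) {s s' : ℝ} (t : ℝ)
    (hs : s ∈ Set.Icc (0 : ℝ) 1) (hs' : s' ∈ Set.Icc (0 : ℝ) 1) :
    ‖ψ (s, t) - ψ (s', t)‖ₑ ^ 2 ≤ ∫⁻ σ, ‖fderiv ℝ ψ (σ, t)‖ₑ ^ 2 ∂unitIntervalMeasure :=
  (pow_le_pow_left₀ zero_le (enorm_sub_le_lintegral_fst hψ t hs hs') 2).trans
    (sq_lintegral_le _ ((measurable_enorm_fderiv hψ).comp measurable_prodMk_right).aemeasurable)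

theorem enorm_sub_sq_le_snd (hψ : ContDiff ℝ 1 ψ) (s : ℝ) {t t' : ℝ}
    (ht : t ∈ Set.Icc (0 : ℝ) 1) (ht' : t' ∈ Set.Icc (0 : ℝ) 1) :
    ‖ψ (s, t) - ψ (s, t')‖ₑ ^ 2 ≤ ∫⁻ τ, ‖fderiv ℝ ψ (s, τ)‖ₑ ^ 2 ∂unitIntervalMeasure :=
  (pow_le_pow_left₀ zero_le (enorm_sub_le_lintegral_snd hψ s ht ht') 2).trans
    (sq_lintegral_le _ ((measurable_enorm_fderiv hψ).comp measurable_prodMk_left).aemeasurable)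

theorem lintegral_unitSquare_fst {h : ℝ → ℝ≥0∞} (hh : Measurable h) :
    ∫⁻ x in unitSquare, h x.1 = ∫⁻ s, h s ∂unitIntervalMeasure := by
  rw [volume_restrict_unitSquare, lintegral_prod _ (by fun_prop)]
  simp

theorem lintegral_unitSquare_snd {h : ℝ → ℝ≥0∞} (hh : Measurable h) :
    ∫⁻ x in unitSquare, h x.2 = ∫⁻ s, h s ∂unitIntervalMeasure := by
  rw [volume_restrict_unitSquare, lintegral_prod _ (by fun_prop)]
  simp

theorem lintegral_unitSquare {h : ℝ × ℝ → ℝ≥0∞} (hh : Measurable h) :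
    ∫⁻ x in unitSquare, h x =
      ∫⁻ s, ∫⁻ t, h (s, t) ∂unitIntervalMeasure ∂unitIntervalMeasure := by
  rw [volume_restrict_unitSquare, lintegral_prod _ hh.aemeasurable]

theorem lintegral_unitSquare_symm {h : ℝ × ℝ → ℝ≥0∞} (hh : Measurable h) :
    ∫⁻ x in unitSquare, h x =
      ∫⁻ t, ∫⁻ s, h (s, t) ∂unitIntervalMeasure ∂unitIntervalMeasure := by
  rw [volume_restrict_unitSquare, lintegral_prod_symm _ hh.aemeasurable]

/-- A trace inequality on the unit square. -/
theorem lintegral_unitSquare_sq_le_base (hψ : ContDiff ℝ 1 ψ) :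
    ∫⁻ x in unitSquare, ‖ψ x‖ₑ ^ 2 ≤ 2 * (∫⁻ x in unitSquare, ‖fderiv ℝ ψ x‖ₑ ^ 2) +
      2 * ∫⁻ s, ‖ψ (s, 0)‖ₑ ^ 2 ∂unitIntervalMeasure := by
  have hm := (measurable_enorm_fderiv hψ).pow_const 2
  have hc := hψ.continuous
  rw [lintegral_unitSquare hm, lintegral_unitSquare (by fun_prop), ← mul_add, ← lintegral_add_left
    (by exact hm.lintegral_prod_right'), ← lintegral_const_mul' _ _ (by simp)]
  refine lintegral_mono fun s => ?_
  calc ∫⁻ t, ‖ψ (s, t)‖ₑ ^ 2 ∂unitIntervalMeasure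
      ≤ ∫⁻ _, 2 * ((∫⁻ τ, ‖fderiv ℝ ψ (s, τ)‖ₑ ^ 2 ∂unitIntervalMeasure) + ‖ψ (s, 0)‖ₑ ^ 2)
        ∂unitIntervalMeasure := by
        refine setLIntegral_mono' measurableSet_Ioo fun t ht => ?_
        have h1 := enorm_sub_sq_le_snd hψ s (Set.Ioo_subset_Icc_self ht)
          (Set.left_mem_Icc.2 zero_le_one)
        calc ‖ψ (s, t)‖ₑ ^ 2 = ‖(ψ (s, t) - ψ (s, 0)) + ψ (s, 0)‖ₑ ^ 2 := by simp
          _ ≤ (‖ψ (s, t) - ψ (s, 0)‖ₑ + ‖ψ (s, 0)‖ₑ) ^ 2 := by gcongr; exact enorm_add_le _ _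
          _ ≤ _ := ENNReal.add_sq_le _ _
          _ ≤ _ := by gcongr
    _ = _ := by simp

/-- A Poincaré inequality on the unit square, with the mean over a measurable subset. -/
theorem lintegral_unitSquare_sq_le_subset (hψ : ContDiff ℝ 1 ψ) {E : Set (ℝ × ℝ)}
    (hE : MeasurableSet E) (hEQ : E ⊆ unitSquare) :
    volume E * ∫⁻ x in unitSquare, ‖ψ x‖ₑ ^ 2 ≤ 8 * (∫⁻ x in unitSquare, ‖fderiv ℝ ψ x‖ₑ ^ 2) +
      2 * ∫⁻ x in E, ‖ψ x‖ₑ ^ 2 := by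
  have hm := (measurable_enorm_fderiv hψ).pow_const 2
  have hc := hψ.continuous
  set H1 : ℝ → ℝ≥0∞ := fun t => ∫⁻ σ, ‖fderiv ℝ ψ (σ, t)‖ₑ ^ 2 ∂unitIntervalMeasure with hH1
  set H2 : ℝ → ℝ≥0∞ := fun s => ∫⁻ τ, ‖fderiv ℝ ψ (s, τ)‖ₑ ^ 2 ∂unitIntervalMeasure with hH2
  set G := ∫⁻ x in unitSquare, ‖fderiv ℝ ψ x‖ₑ ^ 2 with hG
  have mH1 : Measurable H1 := hm.lintegral_prod_left'
  have mH2 : Measurable H2 := hm.lintegral_prod_right'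
  have iH1 : ∫⁻ x in unitSquare, H1 x.2 = G := by
    rw [lintegral_unitSquare_snd mH1, hG, lintegral_unitSquare_symm hm]
  have iH2 : ∫⁻ x in unitSquare, H2 x.1 = G := by
    rw [lintegral_unitSquare_fst mH2, hG, lintegral_unitSquare hm]
  have hvE : volume E ≤ 1 := by
    calc volume E = volume.restrict unitSquare E := (Measure.restrict_eq_self _ hEQ).symm
      _ ≤ 1 := prob_le_one
  -- Go from x to y horizontally at the height of x, then vertically at the abscissa of y. Each
  -- error then depends on one coordinate only, and integrating it gives at most the full energy.
  have key : ∀ x ∈ unitSquare, ∀ y ∈ E,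
      ‖ψ x‖ₑ ^ 2 ≤ 4 * (H1 x.2 + H2 y.1) + 2 * ‖ψ y‖ₑ ^ 2 := by
    rintro ⟨s, t⟩ hx ⟨s', t'⟩ hy
    have hy := hEQ hy
    have h1 := enorm_sub_sq_le_fst hψ t (Set.Ioo_subset_Icc_self hx.1)
      (Set.Ioo_subset_Icc_self hy.1)
    have h2 := enorm_sub_sq_le_snd hψ s' (Set.Ioo_subset_Icc_self hx.2)
      (Set.Ioo_subset_Icc_self hy.2)
    calc ‖ψ (s, t)‖ₑ ^ 2
        = ‖((ψ (s, t) - ψ (s', t)) + (ψ (s', t) - ψ (s', t'))) + ψ (s', t')‖ₑ ^ 2 := by simp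
      _ ≤ (‖(ψ (s, t) - ψ (s', t)) + (ψ (s', t) - ψ (s', t'))‖ₑ + ‖ψ (s', t')‖ₑ) ^ 2 := by
        gcongr; exact enorm_add_le _ _
      _ ≤ 2 * (‖(ψ (s, t) - ψ (s', t)) + (ψ (s', t) - ψ (s', t'))‖ₑ ^ 2 + ‖ψ (s', t')‖ₑ ^ 2) :=
        ENNReal.add_sq_le _ _
      _ ≤ 2 * ((‖ψ (s, t) - ψ (s', t)‖ₑ + ‖ψ (s', t) - ψ (s', t')‖ₑ) ^ 2
          + ‖ψ (s', t')‖ₑ ^ 2) := by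
        gcongr; exact enorm_add_le _ _
      _ ≤ 2 * (2 * (‖ψ (s, t) - ψ (s', t)‖ₑ ^ 2 + ‖ψ (s', t) - ψ (s', t')‖ₑ ^ 2)
          + ‖ψ (s', t')‖ₑ ^ 2) := by
        gcongr; exact ENNReal.add_sq_le _ _
      _ ≤ 2 * (2 * (H1 t + H2 s') + ‖ψ (s', t')‖ₑ ^ 2) := by gcongr
      _ = _ := by ring
  calc volume E * ∫⁻ x in unitSquare, ‖ψ x‖ₑ ^ 2
      = ∫⁻ x in unitSquare, ∫⁻ y in E, ‖ψ x‖ₑ ^ 2 := by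
        rw [← lintegral_const_mul _ (by fun_prop)]
        simp [mul_comm]
    _ ≤ ∫⁻ x in unitSquare, (4 * H1 x.2 + (4 * G + 2 * ∫⁻ y in E, ‖ψ y‖ₑ ^ 2)) := by
        refine setLIntegral_mono' measurableSet_unitSquare fun x hx => ?_
        calc ∫⁻ y in E, ‖ψ x‖ₑ ^ 2
            ≤ ∫⁻ y in E, (4 * (H1 x.2 + H2 y.1) + 2 * ‖ψ y‖ₑ ^ 2) :=
              setLIntegral_mono' hE fun y hy => key x hx y hy
          _ = 4 * (H1 x.2 * volume E + ∫⁻ y in E, H2 y.1) + 2 * ∫⁻ y in E, ‖ψ y‖ₑ ^ 2 := by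
              rw [lintegral_add_left (by fun_prop), lintegral_const_mul _ (by fun_prop),
                lintegral_add_left (by fun_prop), lintegral_const_mul _ (by fun_prop)]
              simp
          -- Both error terms end up below 4 G, the first because `volume E ≤ 1`; together they give
          -- the constant 8.
          _ ≤ 4 * (H1 x.2 * 1 + G) + 2 * ∫⁻ y in E, ‖ψ y‖ₑ ^ 2 := by
              gcongr
              exact (lintegral_mono_set hEQ).trans_eq iH2
          _ = _ := by ring
    _ = 4 * G + (4 * G + 2 * ∫⁻ y in E, ‖ψ y‖ₑ ^ 2) := by
        rw [lintegral_add_left (by fun_prop), lintegral_const_mul _ (by fun_prop), iH1]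
        simp
    _ = _ := by ring

/-- The Gagliardo–Nirenberg embedding of `W^{1,1}` into `L²` on the unit square. -/
theorem lintegral_unitSquare_sq_le_W11 (hψ : ContDiff ℝ 1 ψ) :
    ∫⁻ x in unitSquare, ‖ψ x‖ₑ ^ 2 ≤
      (∫⁻ x in unitSquare, (‖ψ x‖ₑ + ‖fderiv ℝ ψ x‖ₑ)) ^ 2 := by
  have hm := measurable_enorm_fderiv hψ
  have hc := hψ.continuous
  have hmm : Measurable fun x => ‖ψ x‖ₑ + ‖fderiv ℝ ψ x‖ₑ := by fun_prop
  -- A value of ψ is at most the mean of |ψ| plus the variation along a line through the point.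
  -- Using the horizontal line once and the vertical line once bounds ψ² by B(s) A(t), whose
  -- integral factorizes.
  set A : ℝ → ℝ≥0∞ := fun t => ∫⁻ σ, (‖ψ (σ, t)‖ₑ + ‖fderiv ℝ ψ (σ, t)‖ₑ) ∂unitIntervalMeasure
  set B : ℝ → ℝ≥0∞ := fun s => ∫⁻ τ, (‖ψ (s, τ)‖ₑ + ‖fderiv ℝ ψ (s, τ)‖ₑ) ∂unitIntervalMeasure
  have mA : Measurable A := hmm.lintegral_prod_left'
  have mB : Measurable B := hmm.lintegral_prod_right'
  have kA : ∀ x ∈ unitSquare, ‖ψ x‖ₑ ≤ A x.2 := by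
    rintro ⟨s, t⟩ hx
    calc ‖ψ (s, t)‖ₑ = ∫⁻ _, ‖ψ (s, t)‖ₑ ∂unitIntervalMeasure := by simp
      _ ≤ ∫⁻ σ, (‖ψ (σ, t)‖ₑ + ∫⁻ σ', ‖fderiv ℝ ψ (σ', t)‖ₑ ∂unitIntervalMeasure)
          ∂unitIntervalMeasure := by
        refine setLIntegral_mono' measurableSet_Ioo fun σ hσ => ?_
        calc ‖ψ (s, t)‖ₑ = ‖ψ (σ, t) + (ψ (s, t) - ψ (σ, t))‖ₑ := by simp
          _ ≤ _ := enorm_add_le _ _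
          _ ≤ _ := by
            gcongr
            exact enorm_sub_le_lintegral_fst hψ t (Set.Ioo_subset_Icc_self hx.1)
              (Set.Ioo_subset_Icc_self hσ)
      _ = A t := by
        have h1 : Measurable fun σ => ‖ψ (σ, t)‖ₑ :=
          hc.enorm.measurable.comp measurable_prodMk_right
        simp only [A]
        rw [lintegral_add_left h1, lintegral_add_left h1]
        simp
  have kB : ∀ x ∈ unitSquare, ‖ψ x‖ₑ ≤ B x.1 := by
    rintro ⟨s, t⟩ hx
    calc ‖ψ (s, t)‖ₑ = ∫⁻ _, ‖ψ (s, t)‖ₑ ∂unitIntervalMeasure := by simp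
      _ ≤ ∫⁻ τ, (‖ψ (s, τ)‖ₑ + ∫⁻ τ', ‖fderiv ℝ ψ (s, τ')‖ₑ ∂unitIntervalMeasure)
          ∂unitIntervalMeasure := by
        refine setLIntegral_mono' measurableSet_Ioo fun τ hτ => ?_
        calc ‖ψ (s, t)‖ₑ = ‖ψ (s, τ) + (ψ (s, t) - ψ (s, τ))‖ₑ := by simp
          _ ≤ _ := enorm_add_le _ _
          _ ≤ _ := by
            gcongr
            exact enorm_sub_le_lintegral_snd hψ s (Set.Ioo_subset_Icc_self hx.2)
              (Set.Ioo_subset_Icc_self hτ)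
      _ = B s := by
        have h1 : Measurable fun τ => ‖ψ (s, τ)‖ₑ :=
          hc.enorm.measurable.comp measurable_prodMk_left
        simp only [B]
        rw [lintegral_add_left h1, lintegral_add_left h1]
        simp
  calc ∫⁻ x in unitSquare, ‖ψ x‖ₑ ^ 2 ≤ ∫⁻ x in unitSquare, B x.1 * A x.2 := by
        refine setLIntegral_mono' measurableSet_unitSquare fun x hx => ?_
        rw [sq]
        exact mul_le_mul' (kB x hx) (kA x hx)
    _ = _ := by
        rw [volume_restrict_unitSquare, lintegral_prod_mul mB.aemeasurable mA.aemeasurable, sq,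
          ← volume_restrict_unitSquare]
        congr 1
        · exact (lintegral_unitSquare hmm).symm
        · exact (lintegral_unitSquare_symm hmm).symm

/-- The W^{1,1} embedding is applied to ψ^{q+1}, whose derivative is (q+1) ψ^q ∇ψ; Cauchy–Schwarz
then splits off ψ^q. Iteration reaches every even exponent. -/
theorem lintegral_unitSquare_pow_step (hψ : ContDiff ℝ 1 ψ) (q : ℕ) :
    ∫⁻ x in unitSquare, ‖ψ x‖ₑ ^ (2 * (q + 1)) ≤
      2 * (q + 1) ^ 2 * (∫⁻ x in unitSquare, ‖ψ x‖ₑ ^ (2 * q)) *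
        ((∫⁻ x in unitSquare, ‖fderiv ℝ ψ x‖ₑ ^ 2) + ∫⁻ x in unitSquare, ‖ψ x‖ₑ ^ 2) := by
  have hm := measurable_enorm_fderiv hψ
  have hc := hψ.continuous
  have h := lintegral_unitSquare_sq_le_W11 (hψ.pow (q + 1))
  have hd : ∀ x, ‖fderiv ℝ (fun y => ψ y ^ (q + 1)) x‖ₑ =
      (q + 1) * (‖ψ x‖ₑ ^ q * ‖fderiv ℝ ψ x‖ₑ) := by
    intro x
    rw [fderiv_fun_pow _ ((hψ.differentiable (by simp)) x), enorm_smul]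
    have : ‖((q + 1 : ℕ) : ℝ)‖ₑ = (q + 1 : ℝ≥0∞) := by
      rw [Real.enorm_natCast]; simp
    simp only [Nat.add_sub_cancel, nsmul_eq_mul, enorm_mul, enorm_pow, this]
    ring
  simp_rw [hd, enorm_pow, ← pow_mul] at h
  rw [mul_comm (q + 1) 2] at h
  refine h.trans ?_
  have hq1 : (1 : ℝ≥0∞) ≤ (q + 1) := le_add_self
  calc (∫⁻ x in unitSquare, (‖ψ x‖ₑ ^ (q + 1) + (q + 1) * (‖ψ x‖ₑ ^ q * ‖fderiv ℝ ψ x‖ₑ))) ^ 2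
      ≤ (∫⁻ x in unitSquare, (‖ψ x‖ₑ ^ q) * ((q + 1) * (‖ψ x‖ₑ + ‖fderiv ℝ ψ x‖ₑ))) ^ 2 := by
        gcongr with x
        calc ‖ψ x‖ₑ ^ (q + 1) + (q + 1) * (‖ψ x‖ₑ ^ q * ‖fderiv ℝ ψ x‖ₑ)
            ≤ (q + 1) * ‖ψ x‖ₑ ^ (q + 1) + (q + 1) * (‖ψ x‖ₑ ^ q * ‖fderiv ℝ ψ x‖ₑ) := by
              gcongr
              exact le_mul_of_one_le_left zero_le hq1
          _ = _ := by ring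
    _ ≤ (∫⁻ x in unitSquare, (‖ψ x‖ₑ ^ q) ^ 2) *
        ∫⁻ x in unitSquare, ((q + 1) * (‖ψ x‖ₑ + ‖fderiv ℝ ψ x‖ₑ)) ^ 2 :=
        sq_lintegral_mul_le _ (by fun_prop) (by fun_prop)
    _ ≤ (∫⁻ x in unitSquare, (‖ψ x‖ₑ ^ q) ^ 2) *
        ∫⁻ x in unitSquare, (2 * (q + 1) ^ 2) * (‖fderiv ℝ ψ x‖ₑ ^ 2 + ‖ψ x‖ₑ ^ 2) := by
        gcongr with x
        calc ((q + 1) * (‖ψ x‖ₑ + ‖fderiv ℝ ψ x‖ₑ)) ^ 2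
            = (q + 1) ^ 2 * (‖ψ x‖ₑ + ‖fderiv ℝ ψ x‖ₑ) ^ 2 := by ring
          _ ≤ (q + 1) ^ 2 * (2 * (‖ψ x‖ₑ ^ 2 + ‖fderiv ℝ ψ x‖ₑ ^ 2)) := by
            gcongr; exact ENNReal.add_sq_le _ _
          _ = _ := by ring
    _ = _ := by
        rw [lintegral_const_mul _ (by fun_prop), lintegral_add_right _ (by fun_prop)]
        simp_rw [← pow_mul, mul_comm q 2]
        ring

/-- The Sobolev embedding of `H¹` into `L^{2q}` on the unit square. -/
theorem exists_lintegral_unitSquare_pow_le (q : ℕ) :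
    ∃ C : NNReal, ∀ ψ : ℝ × ℝ → ℝ, ContDiff ℝ 1 ψ →
      ∫⁻ x in unitSquare, ‖ψ x‖ₑ ^ (2 * q) ≤
        C * ((∫⁻ x in unitSquare, ‖fderiv ℝ ψ x‖ₑ ^ 2) +
          ∫⁻ x in unitSquare, ‖ψ x‖ₑ ^ 2) ^ q := by
  induction q with
  | zero => exact ⟨1, fun ψ _ => by simp⟩
  | succ q ih =>
    obtain ⟨C, hC⟩ := ih
    refine ⟨2 * (q + 1) ^ 2 * C, fun ψ hψ => (lintegral_unitSquare_pow_step hψ q).trans ?_⟩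
    calc _ ≤ 2 * (q + 1) ^ 2 * (C * ((∫⁻ x in unitSquare, ‖fderiv ℝ ψ x‖ₑ ^ 2) +
          ∫⁻ x in unitSquare, ‖ψ x‖ₑ ^ 2) ^ q) * _ := by
            gcongr
            exact hC ψ hψ
      _ = _ := by
        push_cast
        ring

end UnitSquare

/-! ### Affine transfer to parallelograms -/

section Parallelogram

theorem ENNReal.le_inv_mul_of_mul_le {a b c : ℝ≥0∞} (h0 : a ≠ 0) (h1 : a ≠ ⊤) (h : a * b ≤ c) :
    b ≤ a⁻¹ * c := by
  rw [← one_mul b, ← ENNReal.inv_mul_cancel h0 h1, mul_assoc]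
  gcongr

/-- The open parallelogram with corner `z`, spanned by `L (1, 0)` and `L (0, 1)`. -/
def parallelogram (z : Plane) (L : (ℝ × ℝ) ≃L[ℝ] Plane) : Set Plane :=
  (fun x => z + L x) '' unitSquare

variable (z : Plane) (L : (ℝ × ℝ) ≃L[ℝ] Plane)

theorem isOpen_parallelogram : IsOpen (parallelogram z L) :=
  (L.toHomeomorph.trans (Homeomorph.addLeft z)).isOpenMap _ (isOpen_Ioo.prod isOpen_Ioo)

theorem isPreconnected_parallelogram : IsPreconnected (parallelogram z L) :=
  ((convex_Ioo (0 : ℝ) 1).prod (convex_Ioo (0 : ℝ) 1)).isPreconnected.image _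
    (by fun_prop : Continuous fun x => z + L x).continuousOn

/-- Uniqueness of Haar measure supplies the inverse Jacobian κ; only its being positive and finite
matters. -/
theorem exists_lintegral_comp_affine :
    ∃ κ : ℝ≥0∞, κ ≠ 0 ∧ κ ≠ ⊤ ∧ ∀ (E : Set (ℝ × ℝ)) (g : Plane → ℝ≥0∞),
      ∫⁻ x in E, g (z + L x) = κ * ∫⁻ x in (fun x => z + L x) '' E, g x := by
  have := L.isAddHaarMeasure_map (volume : Measure (ℝ × ℝ))
  have h1 := Measure.isAddLeftInvariant_eq_smul (Measure.map L (volume : Measure (ℝ × ℝ))) volume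
  set s := Measure.addHaarScalarFactor (Measure.map L (volume : Measure (ℝ × ℝ))) volume
  refine ⟨s, ?_, ENNReal.coe_ne_top, fun E g => ?_⟩
  · have := Measure.addHaarScalarFactor_pos_of_isAddHaarMeasure
      (Measure.map L (volume : Measure (ℝ × ℝ))) volume
    simpa using this.ne'
  have hT : MeasurableEmbedding fun x => z + L x :=
    (L.toHomeomorph.trans (Homeomorph.addLeft z)).measurableEmbedding
  have hp : MeasurePreserving (fun x => z + L x) (volume : Measure (ℝ × ℝ))
      ((s : ℝ≥0∞) • (volume : Measure Plane)) := by
    refine ⟨hT.measurable, ?_⟩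
    have : (fun x => z + L x) = (fun y => z + y) ∘ L := rfl
    rw [this, ← Measure.map_map (by fun_prop) L.continuous.measurable, h1, Measure.map_smul,
      map_add_left_eq_self]
    rfl
  rw [hp.setLIntegral_comp_emb hT, Measure.restrict_smul, lintegral_smul_measure, smul_eq_mul]

theorem contDiff_comp_affine {φ : Plane → ℝ} (hφ : ContDiff ℝ 1 φ) :
    ContDiff ℝ 1 fun x => φ (z + L x) :=
  hφ.comp (contDiff_const.add L.contDiff)

theorem enorm_gradient (φ : Plane → ℝ) (x : Plane) : ‖gradient φ x‖ₑ = ‖fderiv ℝ φ x‖ₑ := by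
  simp [gradient, enorm_eq_nnnorm]

theorem enorm_fderiv_comp_affine_le {φ : Plane → ℝ} (hφ : ContDiff ℝ 1 φ) (x : ℝ × ℝ) :
    ‖fderiv ℝ (fun x => φ (z + L x)) x‖ₑ ≤
      ‖(L : (ℝ × ℝ) →L[ℝ] Plane)‖ₑ * ‖gradient φ (z + L x)‖ₑ := by
  have h1 : HasFDerivAt (fun x => z + L x) (L : (ℝ × ℝ) →L[ℝ] Plane) x :=
    L.hasFDerivAt.const_add z
  have h2 := ((hφ.differentiable (by simp)) (z + L x)).hasFDerivAt.comp x h1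
  have h3 : fderiv ℝ (fun x => φ (z + L x)) x = _ := h2.fderiv
  rw [h3, enorm_gradient, mul_comm]
  exact ContinuousLinearMap.opENorm_comp_le _ _

theorem exists_parallelogram_pullback :
    ∃ κ M : ℝ≥0∞, κ ≠ 0 ∧ κ ≠ ⊤ ∧ M ≠ ⊤ ∧
      (∀ E : Set Plane, E ⊆ parallelogram z L → ∀ g : Plane → ℝ≥0∞,
        ∫⁻ x in (fun x => z + L x) ⁻¹' E, g (z + L x) = κ * ∫⁻ x in E, g x) ∧
      ∀ φ : Plane → ℝ, ContDiff ℝ 1 φ →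
        ∫⁻ x in unitSquare, ‖fderiv ℝ (fun x => φ (z + L x)) x‖ₑ ^ 2 ≤
          κ * (M * ∫⁻ x in parallelogram z L, ‖gradient φ x‖ₑ ^ 2) := by
  obtain ⟨κ, h0, h1, h⟩ := exists_lintegral_comp_affine z L
  refine ⟨κ, ‖(L : (ℝ × ℝ) →L[ℝ] Plane)‖ₑ ^ 2, h0, h1, by finiteness, fun E hE g => ?_,
    fun φ hφ => ?_⟩
  · rw [h, Set.image_preimage_eq_of_subset (hE.trans (Set.image_subset_range _ _))]
  · calc _ ≤ ∫⁻ x in unitSquare,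
          (‖(L : (ℝ × ℝ) →L[ℝ] Plane)‖ₑ * ‖gradient φ (z + L x)‖ₑ) ^ 2 :=
        lintegral_mono fun x => pow_le_pow_left₀ zero_le
          (enorm_fderiv_comp_affine_le z L hφ x) 2
      _ = _ := by
        rw [h unitSquare fun y => (‖(L : (ℝ × ℝ) →L[ℝ] Plane)‖ₑ * ‖gradient φ y‖ₑ) ^ 2]
        simp_rw [mul_pow]
        rw [lintegral_const_mul' _ _ (by finiteness)]
        rfl

theorem preimage_parallelogram : (fun x => z + L x) ⁻¹' parallelogram z L = unitSquare :=
  Set.preimage_image_eq _ fun _ _ h => L.injective (add_left_cancel h)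

/-- A Poincaré inequality on a parallelogram, with the `L²` norm over a subset. -/
theorem exists_lintegral_parallelogram_sq_le_subset {E : Set Plane} (hE : MeasurableSet E)
    (hEP : E ⊆ parallelogram z L) (hE0 : volume E ≠ 0) :
    ∃ C : ℝ≥0∞, C ≠ ⊤ ∧ ∀ φ : Plane → ℝ, ContDiff ℝ 1 φ →
      ∫⁻ x in parallelogram z L, ‖φ x‖ₑ ^ 2 ≤
        C * ((∫⁻ x in parallelogram z L, ‖gradient φ x‖ₑ ^ 2) + ∫⁻ x in E, ‖φ x‖ₑ ^ 2) := by
  obtain ⟨κ, M, h0, h1, hM, hi, hg⟩ := exists_parallelogram_pullback z L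
  set E' := (fun x => z + L x) ⁻¹' E with hE'
  have hv : volume E' = κ * volume E := by
    simpa using hi E hEP fun _ => 1
  have hv0 : volume E' ≠ 0 := by
    rw [hv]
    exact mul_ne_zero h0 hE0
  have hE'm : MeasurableSet E' := (by fun_prop : Continuous fun x => z + L x).measurable hE
  have hE's : E' ⊆ unitSquare := by
    rw [← preimage_parallelogram z L]
    exact Set.preimage_mono hEP
  have hvt : volume E' ≠ ⊤ := by
    have : volume E' ≤ volume unitSquare := measure_mono hE's
    refine ne_top_of_le_ne_top ?_ this
    have h := measure_ne_top (volume.restrict unitSquare) Set.univ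
    rwa [Measure.restrict_apply_univ] at h
  refine ⟨(volume E')⁻¹ * (8 * M + 2), by finiteness, fun φ hφ => ?_⟩
  have h := lintegral_unitSquare_sq_le_subset (contDiff_comp_affine z L hφ) hE'm hE's
  have e1 := hi _ subset_rfl fun y => ‖φ y‖ₑ ^ 2
  rw [preimage_parallelogram] at e1
  rw [e1, hi _ hEP fun y => ‖φ y‖ₑ ^ 2] at h
  -- Every area integral carries the same factor κ, which can be cancelled.
  have h2 : κ * (volume E' * ∫⁻ x in parallelogram z L, ‖φ x‖ₑ ^ 2) ≤
      κ * ((8 * M + 2) * ((∫⁻ x in parallelogram z L, ‖gradient φ x‖ₑ ^ 2) +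
        ∫⁻ x in E, ‖φ x‖ₑ ^ 2)) := by
    calc _ = volume E' * (κ * ∫⁻ x in parallelogram z L, ‖φ x‖ₑ ^ 2) := by ring
      _ ≤ _ := h
      _ ≤ 8 * (κ * (M * ∫⁻ x in parallelogram z L, ‖gradient φ x‖ₑ ^ 2)) +
          2 * (κ * ∫⁻ x in E, ‖φ x‖ₑ ^ 2) := by gcongr; exact hg φ hφ
      _ = κ * ((8 * M) * (∫⁻ x in parallelogram z L, ‖gradient φ x‖ₑ ^ 2) +
          2 * ∫⁻ x in E, ‖φ x‖ₑ ^ 2) := by ring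
      _ ≤ _ := by
        rw [mul_add (8 * M + 2)]
        gcongr
        · exact le_self_add
        · exact le_add_self
  rw [ENNReal.mul_le_mul_iff_right h0 h1] at h2
  rw [mul_assoc]
  exact ENNReal.le_inv_mul_of_mul_le hv0 hvt h2

/-- A trace inequality on a parallelogram. -/
theorem exists_lintegral_parallelogram_sq_le_base :
    ∃ C : ℝ≥0∞, C ≠ ⊤ ∧ ∀ φ : Plane → ℝ, ContDiff ℝ 1 φ →
      ∫⁻ x in parallelogram z L, ‖φ x‖ₑ ^ 2 ≤
        C * ((∫⁻ x in parallelogram z L, ‖gradient φ x‖ₑ ^ 2) +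
          ∫⁻ s, ‖φ (z + L (s, 0))‖ₑ ^ 2 ∂unitIntervalMeasure) := by
  obtain ⟨κ, M, h0, h1, hM, hi, hg⟩ := exists_parallelogram_pullback z L
  -- The boundary integral is not transformed, so its coefficient keeps κ⁻¹.
  refine ⟨2 * M + κ⁻¹ * 2, by finiteness, fun φ hφ => ?_⟩
  have h := lintegral_unitSquare_sq_le_base (contDiff_comp_affine z L hφ)
  have e1 := hi _ subset_rfl fun y => ‖φ y‖ₑ ^ 2
  rw [preimage_parallelogram] at e1
  rw [e1] at h
  calc _ ≤ κ⁻¹ * (2 * (κ * (M * ∫⁻ x in parallelogram z L, ‖gradient φ x‖ₑ ^ 2)) +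
        2 * ∫⁻ s, ‖φ (z + L (s, 0))‖ₑ ^ 2 ∂unitIntervalMeasure) := by
        refine ENNReal.le_inv_mul_of_mul_le h0 h1 (h.trans ?_)
        gcongr
        exact hg φ hφ
    _ = (κ⁻¹ * κ) * (2 * M) * (∫⁻ x in parallelogram z L, ‖gradient φ x‖ₑ ^ 2) +
        (κ⁻¹ * 2) * ∫⁻ s, ‖φ (z + L (s, 0))‖ₑ ^ 2 ∂unitIntervalMeasure := by ring
    _ ≤ _ := by
        rw [ENNReal.inv_mul_cancel h0 h1, one_mul, mul_add (2 * M + κ⁻¹ * 2)]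
        gcongr
        · exact le_self_add
        · exact le_add_self

/-- The Sobolev embedding of `H¹` into `L^{2q}` on a parallelogram. -/
theorem exists_lintegral_parallelogram_pow_le (q : ℕ) :
    ∃ C : ℝ≥0∞, C ≠ ⊤ ∧ ∀ φ : Plane → ℝ, ContDiff ℝ 1 φ →
      ∫⁻ x in parallelogram z L, ‖φ x‖ₑ ^ (2 * q) ≤
        C * ((∫⁻ x in parallelogram z L, ‖gradient φ x‖ₑ ^ 2) +
          ∫⁻ x in parallelogram z L, ‖φ x‖ₑ ^ 2) ^ q := by
  obtain ⟨κ, M, h0, h1, hM, hi, hg⟩ := exists_parallelogram_pullback z L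
  obtain ⟨C, hC⟩ := exists_lintegral_unitSquare_pow_le q
  refine ⟨κ⁻¹ * (C * (κ * (M + 1)) ^ q), by finiteness, fun φ hφ => ?_⟩
  have h := hC _ (contDiff_comp_affine z L hφ)
  have e1 := hi _ subset_rfl fun y => ‖φ y‖ₑ ^ 2
  have e2 := hi _ subset_rfl fun y => ‖φ y‖ₑ ^ (2 * q)
  rw [preimage_parallelogram] at e1 e2
  rw [e1, e2] at h
  rw [mul_assoc]
  refine ENNReal.le_inv_mul_of_mul_le h0 h1 (h.trans ?_)
  rw [mul_assoc, ← mul_pow]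
  gcongr
  calc _ ≤ _ := add_le_add_left (hg φ hφ) _
    _ = κ * (M * (∫⁻ x in parallelogram z L, ‖gradient φ x‖ₑ ^ 2) +
        1 * ∫⁻ x in parallelogram z L, ‖φ x‖ₑ ^ 2) := by ring
    _ ≤ _ := by
        rw [mul_assoc, mul_add (M + 1)]
        gcongr
        · exact le_self_add
        · exact le_add_self

end Parallelogram

/-! ### Crosses and the four parallelograms at a point -/

section LocalGeometry

/-- The linear equivalence `(s, t) ↦ L (a s, b t)`. -/
noncomputable def rescale (L : (ℝ × ℝ) ≃L[ℝ] Plane) {a b : ℝ} (ha : a ≠ 0) (hb : b ≠ 0) :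
    (ℝ × ℝ) ≃L[ℝ] Plane :=
  ((ContinuousLinearEquiv.unitsEquivAut ℝ (Units.mk0 a ha)).prodCongr
    (ContinuousLinearEquiv.unitsEquivAut ℝ (Units.mk0 b hb))).trans L

theorem rescale_apply (L : (ℝ × ℝ) ≃L[ℝ] Plane) {a b : ℝ} (ha : a ≠ 0) (hb : b ≠ 0)
    (x : ℝ × ℝ) : rescale L ha hb x = L (x.1 * a, x.2 * b) := rfl

/-- The union of the two lines through `z` in the directions `L (1, 0)` and `L (0, 1)`. -/
def cross (z : Plane) (L : (ℝ × ℝ) ≃L[ℝ] Plane) : Set Plane :=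
  (fun x => z + L x) '' {x | x.1 = 0 ∨ x.2 = 0}

/-- The open parallelograms at z miss the cross; nullity makes this harmless for integrals. -/
theorem volume_cross (z : Plane) (L : (ℝ × ℝ) ≃L[ℝ] Plane) : volume (cross z L) = 0 := by
  obtain ⟨κ, h0, -, h⟩ := exists_lintegral_comp_affine z L
  have h1 := h {x | x.1 = 0 ∨ x.2 = 0} fun _ => 1
  have h2 : volume {x : ℝ × ℝ | x.1 = 0 ∨ x.2 = 0} = 0 := by
    have e : {x : ℝ × ℝ | x.1 = 0 ∨ x.2 = 0} =
        ({0} : Set ℝ) ×ˢ (Set.univ : Set ℝ) ∪ (Set.univ : Set ℝ) ×ˢ ({0} : Set ℝ) := by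
      ext x
      simp
    rw [e, measure_union_null_iff, Measure.volume_eq_prod, Measure.prod_prod, Measure.prod_prod]
    simp
  simp only [lintegral_const, Measure.restrict_apply_univ, one_mul, h2] at h1
  exact (mul_eq_zero.1 h1.symm).resolve_left h0

theorem exists_mem_Ioo_of_abs_lt {x r : ℝ} (hx : x ≠ 0) (hr : |x| < r) :
    ∃ a ∈ ({r, -r} : Set ℝ), ∃ s ∈ Set.Ioo (0 : ℝ) 1, x = s * a := by
  have hr0 : 0 < r := (abs_nonneg x).trans_lt hr
  rcases lt_or_gt_of_ne hx with h | h
  · rw [abs_of_neg h] at hr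
    exact ⟨-r, by simp, -x / r, ⟨div_pos (by linarith) hr0, (div_lt_one hr0).2 hr⟩,
      by field_simp⟩
  · rw [abs_of_pos h] at hr
    exact ⟨r, by simp, x / r, ⟨div_pos h hr0, (div_lt_one hr0).2 hr⟩, by field_simp⟩

/-- If a set is contained in a cross near its center `z`, then the four small parallelograms
at `z` avoid it, and they cover a neighborhood of `z` up to the cross. -/
theorem exists_parallelograms_of_subset_cross {F : Set Plane} {z : Plane}
    {L : (ℝ × ℝ) ≃L[ℝ] Plane} (h : ∀ᶠ x in 𝓝 z, x ∈ F → x ∈ cross z L) {R : ℝ} (hR : 0 < R) :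
    ∃ r : ℝ, ∃ hr : 0 < r, r < R ∧
      (∀ a : ℝ, a ∈ ({r, -r} : Set ℝ) → ∀ b ∈ ({r, -r} : Set ℝ), ∀ ha : a ≠ 0, ∀ hb : b ≠ 0,
        Disjoint (parallelogram z (rescale L ha hb)) F) ∧
      ∀ᶠ x in 𝓝 z, x ∈ cross z L ∪
        ((parallelogram z (rescale L hr.ne' hr.ne') ∪
          parallelogram z (rescale L hr.ne' (neg_ne_zero.2 hr.ne'))) ∪
        (parallelogram z (rescale L (neg_ne_zero.2 hr.ne') hr.ne') ∪
          parallelogram z (rescale L (neg_ne_zero.2 hr.ne') (neg_ne_zero.2 hr.ne')))) := by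
  have hT : Tendsto (fun x => z + L x) (𝓝 0) (𝓝 z) := by
    have : Continuous fun x => z + L x := by fun_prop
    simpa using this.tendsto 0
  obtain ⟨ρ, hρ, hρF⟩ := Metric.eventually_nhds_iff_ball.1 (hT.eventually h)
  -- Within radius ρ, in the coordinates of L, the set stays on the cross. The bound R later keeps a
  -- parallelogram's side inside an edge.
  set r := min ρ R / 2 with hrdef
  have hm : 0 < min ρ R := lt_min hρ hR
  have hr : 0 < r := half_pos hm
  have hrρ : r < ρ := (half_lt_self hm).trans_le (min_le_left _ _)
  have hrR : r < R := (half_lt_self hm).trans_le (min_le_right _ _)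
  refine ⟨r, hr, hrR, fun a ha' b hb' ha hb => ?_, ?_⟩
  · rw [Set.disjoint_left]
    rintro _ ⟨x, hx, rfl⟩ hF
    have habs : ∀ a ∈ ({r, -r} : Set ℝ), |a| = r := by
      rintro a (rfl | rfl)
      · exact abs_of_pos hr
      · rw [abs_neg, abs_of_pos hr]
    have hball : ((x.1 * a, x.2 * b) : ℝ × ℝ) ∈ Metric.ball 0 ρ := by
      rw [mem_ball_zero_iff, Prod.norm_def, max_lt_iff]
      simp only [norm_mul, Real.norm_eq_abs, habs a ha', habs b hb', abs_of_pos hx.1.1,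
        abs_of_pos hx.2.1]
      constructor
      · nlinarith [hx.1.2]
      · nlinarith [hx.2.2]
    obtain ⟨y, hy, hyx⟩ := hρF _ hball hF
    have := L.injective (add_left_cancel hyx)
    subst this
    rcases hy with hy | hy
    · exact mul_ne_zero hx.1.1.ne' ha hy
    · exact mul_ne_zero hx.2.1.ne' hb hy
  · have hi : (fun x => z + L x) '' Metric.ball 0 r ∈ 𝓝 z := by
      have := (L.toHomeomorph.trans (Homeomorph.addLeft z)).isOpenMap.image_mem_nhds
        (Metric.ball_mem_nhds (0 : ℝ × ℝ) hr)
      have e : (L.toHomeomorph.trans (Homeomorph.addLeft z)) 0 = z := by simp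
      rwa [e] at this
    filter_upwards [hi]
    rintro _ ⟨⟨s, t⟩, hx, rfl⟩
    by_cases hc : s = 0 ∨ t = 0
    · exact Or.inl ⟨(s, t), hc, rfl⟩
    right
    push Not at hc
    rw [mem_ball_zero_iff, Prod.norm_def, max_lt_iff] at hx
    obtain ⟨a, ha, s', hs', rfl⟩ := exists_mem_Ioo_of_abs_lt hc.1 hx.1
    obtain ⟨b, hb, t', ht', rfl⟩ := exists_mem_Ioo_of_abs_lt hc.2 hx.2
    rcases ha with rfl | rfl <;> rcases hb with rfl | rfl
    · exact Or.inl (Or.inl ⟨(s', t'), ⟨hs', ht'⟩, rfl⟩)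
    · exact Or.inl (Or.inr ⟨(s', t'), ⟨hs', ht'⟩, rfl⟩)
    · exact Or.inr (Or.inl ⟨(s', t'), ⟨hs', ht'⟩, rfl⟩)
    · exact Or.inr (Or.inr ⟨(s', t'), ⟨hs', ht'⟩, rfl⟩)

theorem exists_equiv_of_linearIndependent {d e : Plane} (h : LinearIndependent ℝ ![d, e]) :
    ∃ L : (ℝ × ℝ) ≃L[ℝ] Plane, L (1, 0) = d ∧ L (0, 1) = e := by
  let f : (ℝ × ℝ) →ₗ[ℝ] Plane :=
    (LinearMap.toSpanSingleton ℝ Plane d).coprod (LinearMap.toSpanSingleton ℝ Plane e)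
  have hf : ∀ x, f x = x.1 • d + x.2 • e := fun x => by simp [f]
  have hinj : Function.Injective f := by
    rw [← LinearMap.ker_eq_bot, LinearMap.ker_eq_bot']
    intro x hx
    rw [hf] at hx
    have := LinearIndependent.pair_iff.1 h _ _ hx
    exact Prod.ext this.1 this.2
  have hfr : Module.finrank ℝ (ℝ × ℝ) = Module.finrank ℝ Plane := by simp
  refine ⟨(LinearEquiv.ofInjectiveOfFinrankEq f hinj hfr).toContinuousLinearEquiv, ?_, ?_⟩
  · change f (1, 0) = d
    simp [hf]
  · change f (0, 1) = e
    simp [hf]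

/-- Two directions lie in a common cross, the first one being an axis. -/
theorem exists_equiv_directions {d : Plane} (hd : d ≠ 0) (e : Plane) :
    ∃ L : (ℝ × ℝ) ≃L[ℝ] Plane, L (1, 0) = d ∧
      ((∃ t : ℝ, e = L (t, 0)) ∨ ∃ t : ℝ, e = L (0, t)) := by
  by_cases h : LinearIndependent ℝ ![d, e]
  · obtain ⟨L, h1, h2⟩ := exists_equiv_of_linearIndependent h
    exact ⟨L, h1, Or.inr ⟨1, h2.symm⟩⟩
  -- Parallel directions lie on one axis, so any second axis will do; this covers straight angles.
  · obtain ⟨e', he'⟩ := exists_linearIndependent_pair_of_one_lt_finrank (R := ℝ)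
      (by simp : 1 < Module.finrank ℝ Plane) hd
    obtain ⟨L, h1, -⟩ := exists_equiv_of_linearIndependent he'
    rw [LinearIndependent.pair_iff' hd] at h
    push Not at h
    obtain ⟨t, ht⟩ := h
    refine ⟨L, h1, Or.inl ⟨t, ?_⟩⟩
    rw [← ht, ← h1, ← map_smul]
    simp

end LocalGeometry

/-! ### The boundary of a polygon near a point -/

section Polygon

variable {m : ℕ} [NeZero m] {Ω : Set Plane} {c : Fin m → Plane}

theorem isClosed_polygonEdge (c : Fin m → Plane) (i : Fin m) : IsClosed (polygonEdge c i) := by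
  rw [polygonEdge, segment_eq_image_lineMap]
  exact (isCompact_Icc.image (by fun_prop)).isClosed

theorem exists_eq_add_smul_of_mem_segment {a b z x : Plane} (hz : z ∈ segment ℝ a b)
    (hx : x ∈ segment ℝ a b) : ∃ t : ℝ, x = z + t • (b - a) := by
  rw [segment_eq_image'] at hz hx
  obtain ⟨s, -, rfl⟩ := hz
  obtain ⟨t, -, rfl⟩ := hx
  refine ⟨t - s, ?_⟩
  dsimp only
  rw [sub_smul]
  abel

namespace IsPolygonalDomain

theorem edge_ne_zero (hΩ : IsPolygonalDomain Ω c) (i : Fin m) : c (i + 1) - c i ≠ 0 := by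
  rw [sub_ne_zero]
  intro h
  have h1 := hΩ.corners_injective h
  have h3 := hΩ.three_le
  have h4 : (1 : Fin m) = 0 := by simpa using h1
  have h5 := congrArg Fin.val h4
  rw [Fin.val_zero, Fin.val_one', Nat.mod_eq_of_lt (by omega)] at h5
  omega

/-- A point shared by two edges is an endpoint of both. Corners are distinct, so it is the initial
point of at most one edge and the final point of at most one. -/
theorem exists_edges_at (hΩ : IsPolygonalDomain Ω c) (z : Plane) :
    ∃ i j : Fin m, ∀ k, z ∈ polygonEdge c k → k = i ∨ k = j := by
  by_cases h : ∃ i j, i ≠ j ∧ z ∈ polygonEdge c i ∧ z ∈ polygonEdge c j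
  · obtain ⟨i, j, hij, hi, hj⟩ := h
    refine ⟨i, j, fun k hk => ?_⟩
    by_contra! hne
    have h1 := hΩ.edges_inter i j hij ⟨hi, hj⟩
    have h2 := (hΩ.edges_inter k i hne.1 ⟨hk, hi⟩).1
    obtain ⟨h3, h4⟩ := h1
    have key : ∀ {a b : Fin m}, z = c a → z = c b → a = b := fun ha hb =>
      hΩ.corners_injective (ha.symm.trans hb)
    have key' : ∀ {a b : Fin m}, z = c (a + 1) → z = c (b + 1) → a = b := fun ha hb =>
      add_right_cancel (key ha hb)
    -- Pigeonhole: among three edges two have z in the same role, initial or final, and hence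
    -- coincide.
    rcases h2 with h2 | h2 <;> rcases h3 with h3 | h3 <;> rcases h4 with h4 | h4
    · exact hij (key h3 h4)
    · exact hne.1 (key h2 h3)
    · exact hne.2 (key h2 h4)
    · exact hij (key' h3 h4)
    · exact hij (key h3 h4)
    · exact hne.2 (key' h2 h4)
    · exact hne.1 (key' h2 h3)
    · exact hij (key' h3 h4)
  · push Not at h
    by_cases h' : ∃ i, z ∈ polygonEdge c i
    · obtain ⟨i, hi⟩ := h'
      refine ⟨i, i, fun k hk => ?_⟩
      by_contra! hne
      exact h i k hne.1.symm hi hk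
    · push Not at h'
      exact ⟨0, 0, fun k hk => absurd hk (h' k)⟩

/-- Near any point, the boundary of a polygonal domain is contained in a cross. -/
theorem frontier_subset_cross (hΩ : IsPolygonalDomain Ω c) {z : Plane} {i j : Fin m}
    (hij : ∀ k, z ∈ polygonEdge c k → k = i ∨ k = j) :
    ∃ L : (ℝ × ℝ) ≃L[ℝ] Plane, L (1, 0) = c (i + 1) - c i ∧
      ∀ᶠ x in 𝓝 z, x ∈ frontier Ω → x ∈ cross z L := by
  obtain ⟨L, hL1, hL2⟩ := exists_equiv_directions (hΩ.edge_ne_zero i) (c (j + 1) - c j)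
  refine ⟨L, hL1, ?_⟩
  -- The finitely many closed edges that miss z also miss a neighbourhood of z.
  have h : ∀ k, ∀ᶠ x in 𝓝 z, x ∈ polygonEdge c k → z ∈ polygonEdge c k := by
    intro k
    by_cases hk : z ∈ polygonEdge c k
    · exact Eventually.of_forall fun _ _ => hk
    · filter_upwards [(isClosed_polygonEdge c k).isOpen_compl.mem_nhds hk] with x hx hx'
      exact absurd hx' hx
  filter_upwards [eventually_all.2 h] with x hx hxF
  rw [hΩ.frontier_eq, Set.mem_iUnion] at hxF
  obtain ⟨k, hk⟩ := hxF
  have hz := hx k hk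
  obtain ⟨t, rfl⟩ := exists_eq_add_smul_of_mem_segment hz hk
  rcases hij k hz with rfl | rfl
  · exact ⟨(t, 0), Or.inr rfl, by rw [← hL1, ← map_smul]; simp⟩
  · rcases hL2 with ⟨s, hs⟩ | ⟨s, hs⟩
    · exact ⟨(t * s, 0), Or.inr rfl, by rw [hs, ← map_smul]; simp⟩
    · exact ⟨(0, t * s), Or.inl rfl, by rw [hs, ← map_smul]; simp⟩

end IsPolygonalDomain

/-- A set avoiding the frontier of u meets u in a relatively clopen part. So no discussion of which
side of an edge is interior is needed. -/
theorem IsPreconnected.subset_or_disjoint_of_disjoint_frontier {X : Type*} [TopologicalSpace X]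
    {s u : Set X} (hs : IsPreconnected s) (hu : IsOpen u) (h : Disjoint s (frontier u)) :
    s ⊆ u ∨ Disjoint s u := by
  by_cases hd : (s ∩ u).Nonempty
  · refine Or.inl (hs.subset_of_closure_inter_subset hu hd ?_)
    rintro x ⟨hx, hxs⟩
    by_contra hxu
    exact Set.disjoint_left.1 h hxs ⟨hx, by rwa [hu.interior_eq]⟩
  · exact Or.inr (Set.disjoint_iff_inter_eq_empty.2 (Set.not_nonempty_iff_eq_empty.1 hd))

end Polygon

/-! ### From local inequalities to the whole polygon -/

section Poincare

/-- The `L²` norm on `E` of smooth functions is controlled by the energy on `Ω` and the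
functional `T`. -/
def IsPoincareSet (Ω : Set Plane) (T : (Plane → ℝ) → ℝ≥0∞) (E : Set Plane) : Prop :=
  ∃ C : ℝ≥0∞, C ≠ ⊤ ∧ ∀ φ : Plane → ℝ, ContDiff ℝ 1 φ →
    ∫⁻ x in E, ‖φ x‖ₑ ^ 2 ≤ C * ((∫⁻ x in Ω, ‖gradient φ x‖ₑ ^ 2) + T φ)

/-- The `L^{2q}` norm on `E` of smooth functions is controlled by the energy on `Ω` and the
functional `T`. -/
def IsSobolevSet (Ω : Set Plane) (T : (Plane → ℝ) → ℝ≥0∞) (q : ℕ) (E : Set Plane) : Prop :=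
  ∃ C : ℝ≥0∞, C ≠ ⊤ ∧ ∀ φ : Plane → ℝ, ContDiff ℝ 1 φ →
    ∫⁻ x in E, ‖φ x‖ₑ ^ (2 * q) ≤ C * ((∫⁻ x in Ω, ‖gradient φ x‖ₑ ^ 2) + T φ) ^ q

variable {Ω E F P : Set Plane} {T : (Plane → ℝ) → ℝ≥0∞} {q : ℕ}

theorem IsPoincareSet.mono (h : IsPoincareSet Ω T E) (hFE : F ⊆ E) : IsPoincareSet Ω T F := by
  obtain ⟨C, hC, h⟩ := h
  exact ⟨C, hC, fun φ hφ => (lintegral_mono_set hFE).trans (h φ hφ)⟩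

theorem IsSobolevSet.mono_ae (h : IsSobolevSet Ω T q E) (hFE : F ≤ᵐ[volume] E) :
    IsSobolevSet Ω T q F := by
  obtain ⟨C, hC, h⟩ := h
  exact ⟨C, hC, fun φ hφ => (lintegral_mono' (Measure.restrict_mono_ae hFE) le_rfl).trans (h φ hφ)⟩

theorem IsSobolevSet.mono (h : IsSobolevSet Ω T q E) (hFE : F ⊆ E) : IsSobolevSet Ω T q F :=
  h.mono_ae (Eventually.of_forall hFE)

theorem isSobolevSet_empty : IsSobolevSet Ω T q ∅ := ⟨0, by simp, by simp⟩

theorem IsSobolevSet.union (hE : IsSobolevSet Ω T q E) (hF : IsSobolevSet Ω T q F) :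
    IsSobolevSet Ω T q (E ∪ F) := by
  obtain ⟨C, hC, hE⟩ := hE
  obtain ⟨C', hC', hF⟩ := hF
  refine ⟨C + C', by finiteness, fun φ hφ => (lintegral_union_le _ _ _).trans ?_⟩
  rw [add_mul]
  exact add_le_add (hE φ hφ) (hF φ hφ)

/-- This is the propagation step: control on any overlap of positive measure extends to the whole
parallelogram, with a constant depending on the overlap. -/
theorem IsPoincareSet.to_parallelogram {z : Plane} {L : (ℝ × ℝ) ≃L[ℝ] Plane}
    (hE : IsPoincareSet Ω T E) (hEm : MeasurableSet E) (hEP : E ⊆ parallelogram z L)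
    (hP : parallelogram z L ⊆ Ω) (hE0 : volume E ≠ 0) :
    IsPoincareSet Ω T (parallelogram z L) := by
  obtain ⟨C, hC, hE⟩ := hE
  obtain ⟨C', hC', h⟩ := exists_lintegral_parallelogram_sq_le_subset z L hEm hEP hE0
  refine ⟨C' * (1 + C), by finiteness, fun φ hφ => (h φ hφ).trans ?_⟩
  rw [mul_assoc, add_mul, one_mul]
  gcongr
  · exact (lintegral_mono_set hP).trans le_self_add
  · exact hE φ hφ

theorem exists_parallelogram_nhds {x : Plane} (hΩ : IsOpen Ω) (hx : x ∈ Ω) :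
    ∃ z L, x ∈ parallelogram z L ∧ parallelogram z L ⊆ Ω := by
  obtain ⟨d, hd⟩ := exists_ne (0 : Plane)
  obtain ⟨L, -, -⟩ := exists_equiv_directions hd 0
  have hT : Tendsto (fun y => x + L y) (𝓝 0) (𝓝 x) := by
    have : Continuous fun y => x + L y := by fun_prop
    simpa using this.tendsto 0
  obtain ⟨r, hr, hrΩ⟩ := Metric.eventually_nhds_iff_ball.1 (hT.eventually (hΩ.mem_nhds hx))
  refine ⟨x - L (r / 2, r / 2), rescale L hr.ne' hr.ne',
    ⟨(1 / 2, 1 / 2), ⟨by norm_num, by norm_num⟩, ?_⟩, ?_⟩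
  · have : ((1 / 2 * r, 1 / 2 * r) : ℝ × ℝ) = (r / 2, r / 2) := by ext <;> simp <;> ring
    simp only [rescale_apply, this]
    abel
  · rintro _ ⟨y, hy, rfl⟩
    have : x + L (y.1 * r - r / 2, y.2 * r - r / 2) ∈ Ω := hrΩ _ (by
      rw [mem_ball_zero_iff, Prod.norm_def, max_lt_iff]
      simp only [Real.norm_eq_abs, abs_lt]
      have h1 := hy.1
      have h2 := hy.2
      simp only [Set.mem_Ioo] at h1 h2
      refine ⟨⟨?_, ?_⟩, ?_, ?_⟩ <;> nlinarith)
    have e : ((y.1 * r - r / 2, y.2 * r - r / 2) : ℝ × ℝ) =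
      (y.1 * r, y.2 * r) - (r / 2, r / 2) := rfl
    rw [e, map_sub] at this
    simp only [rescale_apply]
    convert this using 1
    abel

theorem volume_ne_zero_of_isOpen {U : Set Plane} (hU : IsOpen U) (h : U.Nonempty) :
    volume U ≠ 0 := (hU.measure_pos volume h).ne'

/-- The Poincaré inequality propagates through a connected open set. -/
theorem IsPoincareSet.of_isConnected (hΩ : IsOpen Ω) (hc : IsConnected Ω) {U : Set Plane}
    (hU : IsOpen U) (hUΩ : U ⊆ Ω) (hU0 : U.Nonempty) (hP : IsPoincareSet Ω T U)
    {z : Plane} {L : (ℝ × ℝ) ≃L[ℝ] Plane} (hPΩ : parallelogram z L ⊆ Ω) :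
    IsPoincareSet Ω T (parallelogram z L) := by
  have step : ∀ {z : Plane} {L : (ℝ × ℝ) ≃L[ℝ] Plane} {V : Set Plane},
      parallelogram z L ⊆ Ω → IsOpen V → IsPoincareSet Ω T V →
      (parallelogram z L ∩ V).Nonempty → IsPoincareSet Ω T (parallelogram z L) := by
    intro z L V hz hV hVP hne
    have ho := (isOpen_parallelogram z L).inter hV
    exact (hVP.mono Set.inter_subset_right).to_parallelogram ho.measurableSet Set.inter_subset_left hz
      (volume_ne_zero_of_isOpen ho hne)
  -- The constants need not be uniform over these V. A point of Ω in the closure of A has a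
  -- parallelogram neighbourhood that overlaps some V and so is itself a Poincaré set; hence A is
  -- relatively closed in Ω.
  set A : Set Plane := ⋃₀ {V | IsOpen V ∧ IsPoincareSet Ω T V} with hA
  have hAo : IsOpen A := isOpen_sUnion fun V hV => hV.1
  have hΩA : Ω ⊆ A := by
    refine hc.isPreconnected.subset_of_closure_inter_subset hAo ?_ ?_
    · obtain ⟨x, hx⟩ := hU0
      exact ⟨x, hUΩ hx, U, ⟨hU, hP⟩, hx⟩
    · rintro x ⟨hxA, hxΩ⟩
      obtain ⟨z, L, hxP, hPs⟩ := exists_parallelogram_nhds hΩ hxΩ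
      obtain ⟨y, hyP, V, ⟨hV, hVP⟩, hyV⟩ :=
        mem_closure_iff.1 hxA _ (isOpen_parallelogram z L) hxP
      exact ⟨_, ⟨isOpen_parallelogram z L, step hPs hV hVP ⟨y, hyP, hyV⟩⟩, hxP⟩
  have hne : (parallelogram z L).Nonempty :=
    ⟨_, (1 / 2, 1 / 2), ⟨by norm_num, by norm_num⟩, rfl⟩
  obtain ⟨y, hy⟩ := hne
  obtain ⟨V, ⟨hV, hVP⟩, hyV⟩ := hΩA (hPΩ hy)
  exact step hPΩ hV hVP ⟨y, hy, hyV⟩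

/-- The local embedding involves the full H¹ norm; the Poincaré bound removes its L² part. -/
theorem IsPoincareSet.isSobolevSet {z : Plane} {L : (ℝ × ℝ) ≃L[ℝ] Plane}
    (h : IsPoincareSet Ω T (parallelogram z L)) (hP : parallelogram z L ⊆ Ω) (q : ℕ) :
    IsSobolevSet Ω T q (parallelogram z L) := by
  obtain ⟨C, hC, h⟩ := h
  obtain ⟨C', hC', h'⟩ := exists_lintegral_parallelogram_pow_le z L q
  refine ⟨C' * (1 + C) ^ q, by finiteness, fun φ hφ => (h' φ hφ).trans ?_⟩
  rw [mul_assoc, ← mul_pow, add_mul, one_mul]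
  gcongr
  · exact (lintegral_mono_set hP).trans le_self_add
  · exact h φ hφ

variable {m : ℕ} [NeZero m] {c : Fin m → Plane}

/-- Globalization of the Sobolev inequality on a polygonal domain. -/
theorem IsPoincareSet.isSobolevSet_polygon (hΩ : IsPolygonalDomain Ω c) {U : Set Plane}
    (hU : IsOpen U) (hUΩ : U ⊆ Ω) (hU0 : U.Nonempty) (hP : IsPoincareSet Ω T U) (q : ℕ) :
    IsSobolevSet Ω T q Ω := by
  have hcpt : IsCompact (closure Ω) := hΩ.isBounded.isCompact_closure
  suffices h : IsSobolevSet Ω T q (Ω ∩ closure Ω) from h.mono fun x hx => ⟨hx, subset_closure hx⟩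
  refine hcpt.induction_on (p := fun s => IsSobolevSet Ω T q (Ω ∩ s)) ?_ ?_ ?_ ?_
  · simpa using isSobolevSet_empty
  · exact fun s t hst h => h.mono (Set.inter_subset_inter_right _ hst)
  · intro s t hs ht
    rw [Set.inter_union_distrib_left]
    exact hs.union ht
  · intro z _
    obtain ⟨i, j, hij⟩ := hΩ.exists_edges_at z
    obtain ⟨L, -, hL⟩ := hΩ.frontier_subset_cross hij
    obtain ⟨r, hr, -, hdisj, hcover⟩ := exists_parallelograms_of_subset_cross hL one_pos
    refine ⟨_, mem_nhdsWithin_of_mem_nhds hcover, ?_⟩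
    have key : ∀ a : ℝ, a ∈ ({r, -r} : Set ℝ) → ∀ b ∈ ({r, -r} : Set ℝ),
        ∀ ha : a ≠ 0, ∀ hb : b ≠ 0,
        IsSobolevSet Ω T q (Ω ∩ parallelogram z (rescale L ha hb)) := by
      intro a ha' b hb' ha hb
      rcases (isPreconnected_parallelogram z _).subset_or_disjoint_of_disjoint_frontier hΩ.isOpen
        (hdisj a ha' b hb' ha hb) with h | h
      · exact ((hP.of_isConnected hΩ.isOpen hΩ.isConnected hU hUΩ hU0 h).isSobolevSet h q).mono
          Set.inter_subset_right
      · rw [Set.inter_comm, Set.disjoint_iff_inter_eq_empty.1 h]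
        exact isSobolevSet_empty
    have hr1 : r ∈ ({r, -r} : Set ℝ) := by simp
    have hr2 : -r ∈ ({r, -r} : Set ℝ) := by simp
    have h4 := ((key r hr1 r hr1 hr.ne' hr.ne').union
      (key r hr1 (-r) hr2 hr.ne' (neg_ne_zero.2 hr.ne'))).union
      ((key (-r) hr2 r hr1 (neg_ne_zero.2 hr.ne') hr.ne').union
      (key (-r) hr2 (-r) hr2 (neg_ne_zero.2 hr.ne') (neg_ne_zero.2 hr.ne')))
    rw [← Set.inter_union_distrib_left, ← Set.inter_union_distrib_left,
      ← Set.inter_union_distrib_left] at h4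
    -- The neighbourhood exceeds the four parallelograms only by part of the null cross.
    refine h4.mono_ae ?_
    have hz : ∀ᵐ x ∂(volume : Measure Plane), x ∉ cross z L :=
      measure_eq_zero_iff_ae_notMem.1 (volume_cross z L)
    filter_upwards [hz] with x hx
    rintro ⟨h1, h2 | h2⟩
    · exact absurd h2 hx
    · exact ⟨h1, h2⟩

theorem lintegral_arcLengthMeasure (a b : Plane) {g : Plane → ℝ≥0∞} (hg : Measurable g) :
    ∫⁻ x, g x ∂arcLengthMeasure a b =
      ENNReal.ofReal (dist a b) * ∫⁻ t in Set.Icc (0 : ℝ) 1, g (AffineMap.lineMap a b t) := by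
  rw [arcLengthMeasure, lintegral_smul_measure, lintegral_map hg (by fun_prop), smul_eq_mul]

theorem lintegral_unitInterval_affine_le {a β : ℝ} (ha : a ≠ 0)
    (h : ∀ s ∈ Set.Ioo (0 : ℝ) 1, β + s * a ∈ Set.Icc (0 : ℝ) 1) (g : ℝ → ℝ≥0∞) :
    ENNReal.ofReal |a| * ∫⁻ s, g (β + s * a) ∂unitIntervalMeasure ≤
      ∫⁻ t in Set.Icc (0 : ℝ) 1, g t := by
  rw [← lintegral_const_mul' _ _ (by simp)]
  have hd : ∀ s ∈ Set.Ioo (0 : ℝ) 1,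
      HasDerivWithinAt (fun s => β + s * a) a (Set.Ioo (0 : ℝ) 1) s := fun s _ => by
    simpa using (((hasDerivAt_id s).mul_const a).const_add β).hasDerivWithinAt
  have hinj : Set.InjOn (fun s => β + s * a) (Set.Ioo (0 : ℝ) 1) := fun x _ y _ hxy =>
    mul_right_cancel₀ ha (add_left_cancel hxy)
  rw [unitIntervalMeasure,
    ← lintegral_image_eq_lintegral_abs_deriv_mul measurableSet_Ioo hd hinj g]
  refine lintegral_mono_set ?_
  rintro _ ⟨s, hs, rfl⟩
  exact h s hs

/-- The trace inequality near the midpoint of an edge. -/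
theorem IsPolygonalDomain.exists_isPoincareSet (hΩ : IsPolygonalDomain Ω c) (i : Fin m) :
    ∃ U : Set Plane, IsOpen U ∧ U ⊆ Ω ∧ U.Nonempty ∧
      IsPoincareSet Ω (fun φ => ∫⁻ x, ‖φ x‖ₑ ^ 2 ∂arcLengthMeasure (c i) (c (i + 1))) U := by
  have hd0 := hΩ.edge_ne_zero i
  set d := c (i + 1) - c i with hd
  set z := c i + (1 / 2 : ℝ) • d with hz
  have hzi : z ∈ polygonEdge c i := by
    rw [polygonEdge, segment_eq_image']
    exact ⟨1 / 2, by norm_num, rfl⟩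
  have hne1 : z ≠ c i := by
    intro h
    rw [hz, add_eq_left] at h
    exact hd0 ((smul_eq_zero.1 h).resolve_left (by norm_num))
  have hne2 : z ≠ c (i + 1) := by
    intro h
    have h1 : c (i + 1) = c i + d := by rw [hd]; abel
    rw [h1, hz] at h
    have h2 : ((1 / 2 : ℝ) - 1) • d = 0 := by
      rw [sub_smul, one_smul, add_left_cancel h, sub_self]
    exact hd0 ((smul_eq_zero.1 h2).resolve_left (by norm_num))
  -- The midpoint is not a corner, so only edge i passes through it.
  have hij : ∀ k, z ∈ polygonEdge c k → k = i ∨ k = i := by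
    intro k hk
    by_contra! hne
    rcases (hΩ.edges_inter k i hne.1 ⟨hk, hzi⟩).2 with h | h
    · exact hne1 h
    · exact hne2 h
  obtain ⟨L, hL1, hL⟩ := hΩ.frontier_subset_cross hij
  obtain ⟨r, hr, hr2, hdisj, hcover⟩ := exists_parallelograms_of_subset_cross hL
    (by norm_num : (0 : ℝ) < 1 / 2)
  have hzc : z ∈ closure Ω := by
    apply frontier_subset_closure
    rw [hΩ.frontier_eq]
    exact Set.mem_iUnion.2 ⟨i, hzi⟩
  obtain ⟨W, hW, hWo, hzW⟩ := eventually_nhds_iff.1 hcover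
  have hWΩ : (W ∩ Ω).Nonempty := mem_closure_iff.1 hzc W hWo hzW
  -- A nonempty open set cannot lie in the null cross. The parallelogram containing such an x meets
  -- Ω, hence lies in Ω.
  have hx : ∃ x ∈ W ∩ Ω, x ∉ cross z L := by
    by_contra! hall
    exact volume_ne_zero_of_isOpen (hWo.inter hΩ.isOpen) hWΩ
      (measure_mono_null hall (volume_cross z L))
  obtain ⟨x, ⟨hxW, hxΩ⟩, hxc⟩ := hx
  have main : ∀ a : ℝ, a ∈ ({r, -r} : Set ℝ) → ∀ b ∈ ({r, -r} : Set ℝ),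
      ∀ (ha : a ≠ 0) (hb : b ≠ 0), x ∈ parallelogram z (rescale L ha hb) →
      ∃ U : Set Plane, IsOpen U ∧ U ⊆ Ω ∧ U.Nonempty ∧
      IsPoincareSet Ω (fun φ => ∫⁻ x, ‖φ x‖ₑ ^ 2 ∂arcLengthMeasure (c i) (c (i + 1))) U := by
    intro a ha' b hb' ha hb hxP
    have hPΩ : parallelogram z (rescale L ha hb) ⊆ Ω := by
      rcases (isPreconnected_parallelogram z _).subset_or_disjoint_of_disjoint_frontier hΩ.isOpen
        (hdisj a ha' b hb' ha hb) with h | h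
      · exact h
      · exact absurd hxΩ (Set.disjoint_left.1 h hxP)
    refine ⟨_, isOpen_parallelogram z (rescale L ha hb), hPΩ, ⟨x, hxP⟩, ?_⟩
    obtain ⟨C, hC, h⟩ := exists_lintegral_parallelogram_sq_le_base z (rescale L ha hb)
    set ℓ := ENNReal.ofReal (dist (c i) (c (i + 1))) with hℓ
    have hℓ0 : ℓ ≠ 0 := by
      rw [hℓ, Ne, ENNReal.ofReal_eq_zero, not_le, dist_pos]
      exact fun h => hd0 (by rw [hd, ← h, sub_self])
    have hℓt : ℓ ≠ ⊤ := ENNReal.ofReal_ne_top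
    have ha0 : ENNReal.ofReal |a| ≠ 0 := by simpa using ha
    have hat : ENNReal.ofReal |a| ≠ ⊤ := ENNReal.ofReal_ne_top
    -- The factor |a|⁻¹ comes from reparametrizing the base as a piece of the edge, ℓ⁻¹ from the
    -- arc-length normalization.
    refine ⟨C * (1 + (ENNReal.ofReal |a|)⁻¹ * ℓ⁻¹), by finiteness,
      fun φ hφ => (h φ hφ).trans ?_⟩
    have hφm : Measurable fun x => ‖φ x‖ₑ ^ 2 := hφ.continuous.enorm.measurable.pow_const 2
    rw [mul_assoc]
    gcongr
    rw [add_mul, one_mul]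
    refine add_le_add ((lintegral_mono_set hPΩ).trans le_self_add) ?_
    refine le_trans ?_ (mul_le_mul_right (a := (ENNReal.ofReal |a|)⁻¹ * ℓ⁻¹) le_add_self)
    beta_reduce
    rw [lintegral_arcLengthMeasure _ _ hφm, mul_assoc, ← mul_assoc ℓ⁻¹,
      ENNReal.inv_mul_cancel hℓ0 hℓt, one_mul]
    refine ENNReal.le_inv_mul_of_mul_le ha0 hat ?_
    have hab : |a| < 1 / 2 := by
      rcases ha' with rfl | rfl
      · rwa [abs_of_pos hr]
      · rwa [abs_neg, abs_of_pos hr]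
    have hmem : ∀ s ∈ Set.Ioo (0 : ℝ) 1, 1 / 2 + s * a ∈ Set.Icc (0 : ℝ) 1 := by
      intro s hs
      have h1 : |s * a| ≤ 1 / 2 := by
        rw [abs_mul, abs_of_pos hs.1]
        nlinarith [hs.1, hs.2, abs_nonneg a]
      rw [abs_le] at h1
      exact ⟨by linarith, by linarith⟩
    refine le_trans (le_of_eq ?_) (lintegral_unitInterval_affine_le ha hmem
      fun t => ‖φ (AffineMap.lineMap (c i) (c (i + 1)) t)‖ₑ ^ 2)
    congr 2
    ext s
    congr 3
    -- The base point with parameter s is the edge point with parameter 1/2 + s a.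
    rw [rescale_apply, zero_mul, AffineMap.lineMap_apply_module']
    have : ((s * a, 0) : ℝ × ℝ) = (s * a) • (1, 0) := by simp
    rw [this, map_smul, hL1, hz, add_smul]
    abel
  have hr1 : r ∈ ({r, -r} : Set ℝ) := by simp
  have hr2 : -r ∈ ({r, -r} : Set ℝ) := by simp
  rcases hW x hxW with h | (h | h) | (h | h)
  · exact absurd h hxc
  · exact main _ hr1 _ hr1 _ _ h
  · exact main _ hr1 _ hr2 _ _ h
  · exact main _ hr2 _ hr1 _ _ h
  · exact main _ hr2 _ hr2 _ _ h

/-- The Sobolev–Friedrichs inequality for smooth functions on a polygonal domain. -/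
theorem IsPolygonalDomain.isSobolevSet (hΩ : IsPolygonalDomain Ω c) {D : Finset (Fin m)}
    (hD : D.Nonempty) (q : ℕ) :
    IsSobolevSet Ω (fun φ => ∫⁻ x, ‖φ x‖ₑ ^ 2 ∂boundaryMeasure c D) q Ω := by
  obtain ⟨i, hi⟩ := hD
  obtain ⟨U, hU, hUΩ, hU0, hP⟩ := hΩ.exists_isPoincareSet i
  obtain ⟨C, hC, h⟩ := hP.isSobolevSet_polygon hΩ hU hUΩ hU0 q
  refine ⟨C, hC, fun φ hφ => (h φ hφ).trans ?_⟩
  gcongr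
  beta_reduce
  rw [boundaryMeasure, lintegral_finsetSum_measure]
  exact Finset.single_le_sum
    (f := fun i => ∫⁻ x, ‖φ x‖ₑ ^ 2 ∂arcLengthMeasure (c i) (c (i + 1))) (fun _ _ => zero_le) hi

end Poincare

/-! ### Passage from smooth functions to H¹_D -/

section SobolevH1D

variable {m : ℕ} [NeZero m] {Ω : Set Plane} {c : Fin m → Plane}

theorem sq_eLpNorm_two {α E : Type*} [MeasurableSpace α] [NormedAddCommGroup E] (μ : Measure α)
    (f : α → E) : eLpNorm f 2 μ ^ 2 = ∫⁻ x, ‖f x‖ₑ ^ 2 ∂μ := by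
  have := eLpNorm_nnreal_pow_eq_lintegral (f := f) (μ := μ) (p := 2) two_ne_zero
  simpa using this

theorem eLpNorm_two_le_sub_add {α E : Type*} [MeasurableSpace α] [NormedAddCommGroup E]
    {μ : Measure α} {f g : α → E} (hf : AEStronglyMeasurable f μ)
    (hg : AEStronglyMeasurable g μ) :
    eLpNorm f 2 μ ≤ eLpNorm (fun x => f x - g x) 2 μ + eLpNorm g 2 μ := by
  have h := eLpNorm_add_le (hf.sub hg) hg (by norm_num : (1 : ℝ≥0∞) ≤ 2)
  rwa [sub_add_cancel] at h

/-- Convergence in L² gives an a.e. convergent subsequence, and Fatou's lemma then yields the L^{2q}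
bound in the limit. The boundary term vanishes by the zero trace. -/
theorem IsSobolevSet.lintegral_le_of_hasZeroTrace {D : Finset (Fin m)} {q : ℕ} {C : ℝ≥0∞}
    (hC : C ≠ ⊤)
    (h : ∀ φ : Plane → ℝ, ContDiff ℝ 1 φ → ∫⁻ x in Ω, ‖φ x‖ₑ ^ (2 * q) ≤
      C * ((∫⁻ x in Ω, ‖gradient φ x‖ₑ ^ 2) + ∫⁻ x, ‖φ x‖ₑ ^ 2 ∂boundaryMeasure c D) ^ q)
    {v : SobolevH1 Ω} (hv : HasZeroTrace c D v) :
    ∫⁻ x in Ω, ‖h1Fun v x‖ₑ ^ (2 * q) ≤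
      C * (eLpNorm (h1Grad v) 2 (volume.restrict Ω) ^ 2) ^ q := by
  obtain ⟨φ, h1, h2, h3, h4⟩ := hv
  have hmeas := tendstoInMeasure_of_tendsto_eLpNorm two_ne_zero
    (fun n => (h1 n).continuous.aestronglyMeasurable) (Lp.aestronglyMeasurable (h1Fun v)) h2
  obtain ⟨ns, hns, hlim⟩ := hmeas.exists_seq_tendsto_ae
  set N := eLpNorm (h1Grad v) 2 (volume.restrict Ω)
  set ε := fun n => eLpNorm (fun x => gradient (φ n) x - h1Grad v x) 2 (volume.restrict Ω)
  set τ := fun n => eLpNorm (φ n) 2 (boundaryMeasure c D)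
  have hbound : ∀ n, ∫⁻ x in Ω, ‖φ n x‖ₑ ^ (2 * q) ≤ C * ((ε n + N) ^ 2 + τ n ^ 2) ^ q := by
    intro n
    refine (h (φ n) ((h1 n).of_le (by simp))).trans ?_
    rw [← sq_eLpNorm_two, ← sq_eLpNorm_two]
    gcongr
    exact eLpNorm_two_le_sub_add (continuous_gradient_of_contDiff (h1 n)).aestronglyMeasurable
      (Lp.aestronglyMeasurable (h1Grad v))
  have hT : Tendsto (fun n => C * ((ε n + N) ^ 2 + τ n ^ 2) ^ q) atTop (𝓝 (C * (N ^ 2) ^ q)) := by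
    refine ENNReal.Tendsto.const_mul ?_ (Or.inr hC)
    have h5 : Tendsto (fun n => (ε n + N) ^ 2 + τ n ^ 2) atTop (𝓝 ((0 + N) ^ 2 + 0 ^ 2)) :=
      (ENNReal.Tendsto.pow (h3.add tendsto_const_nhds)).add (ENNReal.Tendsto.pow h4)
    have h6 := ENNReal.Tendsto.pow (n := q) h5
    simpa using h6
  have hlim' : ∀ᵐ x ∂(volume.restrict Ω : Measure Plane),
      liminf (fun i => ‖φ (ns i) x‖ₑ ^ (2 * q)) atTop = ‖h1Fun v x‖ₑ ^ (2 * q) := by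
    filter_upwards [hlim] with x hx
    exact (ENNReal.Tendsto.pow hx.enorm).liminf_eq
  calc ∫⁻ x in Ω, ‖h1Fun v x‖ₑ ^ (2 * q)
      = ∫⁻ x in Ω, liminf (fun i => ‖φ (ns i) x‖ₑ ^ (2 * q)) atTop :=
        lintegral_congr_ae (hlim'.mono fun _ hx => hx.symm)
    _ ≤ liminf (fun i => ∫⁻ x in Ω, ‖φ (ns i) x‖ₑ ^ (2 * q)) atTop :=
        lintegral_liminf_le' fun i =>
          ((h1 (ns i)).continuous.enorm.measurable.pow_const _).aemeasurable
    _ ≤ liminf (fun i => C * ((ε (ns i) + N) ^ 2 + τ (ns i) ^ 2) ^ q) atTop :=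
        liminf_le_liminf (Eventually.of_forall fun i => hbound (ns i))
    _ = C * (N ^ 2) ^ q := (hT.comp hns.tendsto_atTop).liminf_eq

/-- The Sobolev–Friedrichs inequality on `H¹_D(Ω)`, with a constant that does not depend on the
Dirichlet part of the boundary. -/
theorem IsPolygonalDomain.exists_sobolev_friedrichs (hΩ : IsPolygonalDomain Ω c) (q : ℕ) :
    ∃ C : ℝ, 0 ≤ C ∧ ∀ D : Finset (Fin m), D.Nonempty → ∀ v ∈ SobolevH1D Ω c D,
      Integrable (fun x => h1Fun v x ^ (2 * q)) (volume.restrict Ω) ∧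
      ∫ x in Ω, h1Fun v x ^ (2 * q) ≤ C * gradNorm v ^ (2 * q) := by
  have h : ∀ D : Finset (Fin m), ∃ C : ℝ≥0∞, C ≠ ⊤ ∧ (D.Nonempty → ∀ v ∈ SobolevH1D Ω c D,
      ∫⁻ x in Ω, ‖h1Fun v x‖ₑ ^ (2 * q) ≤
        C * (eLpNorm (h1Grad v) 2 (volume.restrict Ω) ^ 2) ^ q) := by
    intro D
    by_cases hD : D.Nonempty
    · obtain ⟨C, hC, h⟩ := hΩ.isSobolevSet hD q
      exact ⟨C, hC, fun _ v hv => IsSobolevSet.lintegral_le_of_hasZeroTrace hC h hv⟩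
    · exact ⟨0, by simp, fun h => absurd h hD⟩
  choose C hC h using h
  -- There are finitely many D, so the sum of their constants serves for all of them.
  have hsum : ∑ D, C D ≠ ⊤ := by
    simpa using fun D => (hC D)
  refine ⟨(∑ D, C D).toReal, ENNReal.toReal_nonneg, fun D hD v hv => ?_⟩
  have h1 : ∫⁻ x in Ω, ‖h1Fun v x ^ (2 * q)‖ₑ ≤
      (∑ D, C D) * eLpNorm (h1Grad v) 2 (volume.restrict Ω) ^ (2 * q) := by
    simp_rw [enorm_pow]
    refine (h D hD v hv).trans ?_
    rw [← pow_mul]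
    gcongr
    exact Finset.single_le_sum (fun _ _ => zero_le) (Finset.mem_univ D)
  have hN : eLpNorm (h1Grad v) 2 (volume.restrict Ω) ≠ ⊤ := Lp.eLpNorm_ne_top (h1Grad v)
  have htop : (∑ D, C D) * eLpNorm (h1Grad v) 2 (volume.restrict Ω) ^ (2 * q) ≠ ⊤ := by
    finiteness
  have hm : AEStronglyMeasurable (fun x => h1Fun v x ^ (2 * q)) (volume.restrict Ω) :=
    (Lp.aestronglyMeasurable (h1Fun v)).pow _
  refine ⟨⟨hm, lt_of_le_of_lt h1 htop.lt_top⟩, ?_⟩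
  have h2 : ∫ x in Ω, h1Fun v x ^ (2 * q) = (∫⁻ x in Ω, ‖h1Fun v x ^ (2 * q)‖ₑ).toReal := by
    rw [← integral_norm_eq_lintegral_enorm hm]
    congr 1
    ext x
    rw [Real.norm_of_nonneg]
    exact (even_two_mul q).pow_nonneg _
  rw [h2]
  refine (ENNReal.toReal_mono htop h1).trans_eq ?_
  rw [ENNReal.toReal_mul, ENNReal.toReal_pow, gradNorm, Lp.norm_def]

end SobolevH1D

/-! ### Monotonicity, a priori bound and quasi-optimality -/

section QuasiOptimality

theorem pow_mul_pow_le_add {x y : ℝ} (hx : 0 ≤ x) (hy : 0 ≤ y) (k l : ℕ) :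
    x ^ k * y ^ l ≤ x ^ (k + l) + y ^ (k + l) := by
  rcases le_total x y with h | h
  · calc x ^ k * y ^ l ≤ y ^ k * y ^ l := by gcongr
      _ = y ^ (k + l) := (pow_add _ _ _).symm
      _ ≤ _ := le_add_of_nonneg_left (by positivity)
  · calc x ^ k * y ^ l ≤ x ^ k * x ^ l := by gcongr
      _ = x ^ (k + l) := (pow_add _ _ _).symm
      _ ≤ _ := le_add_of_nonneg_right (by positivity)

theorem abs_pow_mul_pow_le_add (x y : ℝ) {k l n : ℕ} (hn : k + l = 2 * n) :
    |x ^ k * y ^ l| ≤ x ^ (2 * n) + y ^ (2 * n) := by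
  have := pow_mul_pow_le_add (abs_nonneg x) (abs_nonneg y) k l
  rwa [hn, (even_two_mul n).pow_abs, (even_two_mul n).pow_abs, ← abs_pow, ← abs_pow,
    ← abs_mul] at this

/-- Strong monotonicity of odd powers. -/
theorem half_mul_sq_le_odd_pow_sub_mul (x y : ℝ) (q : ℕ) :
    1 / 2 * ((x ^ (2 * q) + y ^ (2 * q)) * (x - y) ^ 2) ≤
      (x ^ (2 * q + 1) - y ^ (2 * q + 1)) * (x - y) := by
  -- Both factors are differences of nondecreasing functions of the square, so their signs agree.
  have h : 0 ≤ (x ^ (2 * q) - y ^ (2 * q)) * (x ^ 2 - y ^ 2) := by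
    rw [pow_mul, pow_mul]
    rcases le_total (x ^ 2) (y ^ 2) with h | h
    · exact mul_nonneg_of_nonpos_of_nonpos
        (sub_nonpos.2 (pow_le_pow_left₀ (sq_nonneg x) h q)) (sub_nonpos.2 h)
    · exact mul_nonneg (sub_nonneg.2 (pow_le_pow_left₀ (sq_nonneg y) h q)) (sub_nonneg.2 h)
  have e : (x ^ (2 * q + 1) - y ^ (2 * q + 1)) * (x - y) =
      1 / 2 * ((x ^ (2 * q) + y ^ (2 * q)) * (x - y) ^ 2) +
      1 / 2 * ((x ^ (2 * q) - y ^ (2 * q)) * (x ^ 2 - y ^ 2)) := by ring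
  rw [e]
  linarith

/-- Local Lipschitz continuity of odd powers. -/
theorem abs_odd_pow_sub_le (x y : ℝ) (q : ℕ) :
    |x ^ (2 * q + 1) - y ^ (2 * q + 1)| ≤
      (2 * q + 1) * ((x ^ (2 * q) + y ^ (2 * q)) * |x - y|) := by
  rw [← mul_assoc, ← geom_sum₂_mul, abs_mul]
  refine mul_le_mul_of_nonneg_right ?_ (abs_nonneg _)
  refine (Finset.abs_sum_le_sum_abs _ _).trans ?_
  calc ∑ i ∈ Finset.range (2 * q + 1), |x ^ i * y ^ (2 * q + 1 - 1 - i)|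
      ≤ ∑ _i ∈ Finset.range (2 * q + 1), (x ^ (2 * q) + y ^ (2 * q)) := by
        refine Finset.sum_le_sum fun i hi => abs_pow_mul_pow_le_add x y ?_
        have := Finset.mem_range.1 hi
        omega
    _ = _ := by
        simp only [Finset.sum_const, Finset.card_range, nsmul_eq_mul]
        push_cast
        ring

/-- Here x, y, z stand for u, U, w. Split z - y = (x - y) - (x - z): monotonicity supplies a
negative M (x - y)²/2, which exactly absorbs the corresponding term of Young's inequality in `h4`.
-/
theorem neg_odd_pow_sub_mul_le (x y z : ℝ) (q : ℕ) :
    -((x ^ (2 * q + 1) - y ^ (2 * q + 1)) * (z - y)) ≤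
      (2 * q + 1) ^ 2 * ((x ^ (2 * q) + y ^ (2 * q)) * (x - z) ^ 2) := by
  have h1 := half_mul_sq_le_odd_pow_sub_mul x y q
  have h2 := abs_odd_pow_sub_le x y q
  set M := x ^ (2 * q) + y ^ (2 * q)
  have hM : 0 ≤ M := add_nonneg ((even_two_mul q).pow_nonneg x) ((even_two_mul q).pow_nonneg y)
  set P := x ^ (2 * q + 1) - y ^ (2 * q + 1)
  have h3 : P * (x - z) ≤ (2 * q + 1) * (M * |x - y|) * |x - z| := by
    calc P * (x - z) ≤ |P * (x - z)| := le_abs_self _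
      _ = |P| * |x - z| := abs_mul _ _
      _ ≤ _ := by gcongr
  have h4 : (2 * q + 1) * (M * |x - y|) * |x - z| ≤
      1 / 2 * (M * (x - y) ^ 2) + 1 / 2 * ((2 * q + 1) ^ 2 * (M * (x - z) ^ 2)) := by
    rw [← sq_abs (x - y), ← sq_abs (x - z)]
    nlinarith [mul_nonneg hM (sq_nonneg (|x - y| - (2 * q + 1) * |x - z|))]
  have h5 : 0 ≤ (2 * q + 1 : ℝ) ^ 2 * (M * (x - z) ^ 2) := by positivity
  have e : -(P * (z - y)) = P * (x - z) - P * (x - y) := by ring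
  rw [e]
  linarith

variable {Ω : Set Plane} {q : ℕ}

theorem h1Fun_sub_ae (u v : SobolevH1 Ω) :
    ∀ᵐ x ∂(volume.restrict Ω : Measure Plane), h1Fun (u - v) x = h1Fun u x - h1Fun v x :=
  Lp.coeFn_sub (h1Fun u) (h1Fun v)

theorem formA_eq_inner (v w : SobolevH1 Ω) : formA v w = inner ℝ (h1Grad v) (h1Grad w) := rfl

/-- `v` lies in `L^{2q+2}(Ω)`. -/
def HasPowerIntegrable (q : ℕ) (v : SobolevH1 Ω) : Prop :=
  Integrable (fun x => h1Fun v x ^ (2 * (q + 1))) (volume.restrict Ω)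

/-- Mixed terms of total degree 2q+2 are dominated by pure powers. This makes every integral in the
argument genuine, not the default value 0. -/
theorem HasPowerIntegrable.integrable_pow_mul_pow {u v : SobolevH1 Ω}
    (hu : HasPowerIntegrable q u) (hv : HasPowerIntegrable q v) {k l : ℕ}
    (hkl : k + l = 2 * (q + 1)) :
    Integrable (fun x => h1Fun u x ^ k * h1Fun v x ^ l) (volume.restrict Ω) :=
  (hu.add hv).mono' (((Lp.aestronglyMeasurable (h1Fun u)).pow k).mul
    ((Lp.aestronglyMeasurable (h1Fun v)).pow l))
    (Eventually.of_forall fun _ => abs_pow_mul_pow_le_add _ _ hkl)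

theorem HasPowerIntegrable.integrable_formB {u v : SobolevH1 Ω}
    (hu : HasPowerIntegrable q u) (hv : HasPowerIntegrable q v) :
    Integrable (fun x => h1Fun u x ^ (2 * q + 1) * h1Fun v x) (volume.restrict Ω) := by
  simpa using hu.integrable_pow_mul_pow hv (by ring : (2 * q + 1) + 1 = 2 * (q + 1))

/-- The weighted `L²` norm is controlled by powers; the parameter `s` replaces Hölder's inequality
by a scaling argument. -/
theorem integral_pow_mul_sq_le {u η : SobolevH1 Ω} (hu : HasPowerIntegrable q u)
    (hη : HasPowerIntegrable q η) {s : ℝ} (hs : 0 < s) :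
    ∫ x in Ω, h1Fun u x ^ (2 * q) * h1Fun η x ^ 2 ≤
      s ^ 2 * ((∫ x in Ω, h1Fun u x ^ (2 * (q + 1))) +
        (∫ x in Ω, h1Fun η x ^ (2 * (q + 1))) / s ^ (2 * (q + 1))) := by
  rw [← integral_div, ← integral_add hu (hη.div_const _), ← integral_const_mul]
  refine integral_mono (hu.integrable_pow_mul_pow hη (by ring))
    ((hu.add (hη.div_const _)).const_mul _) fun x => ?_
  have h := (le_abs_self _).trans
    (abs_pow_mul_pow_le_add (h1Fun u x) (h1Fun η x / s) (by ring : 2 * q + 2 = 2 * (q + 1)))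
  rw [div_pow, div_pow] at h
  calc h1Fun u x ^ (2 * q) * h1Fun η x ^ 2
      = s ^ 2 * (h1Fun u x ^ (2 * q) * (h1Fun η x ^ 2 / s ^ 2)) := by
        field_simp
    _ ≤ _ := by
        gcongr

/-- A priori bound for Galerkin solutions in `L^{2q+2}(Ω)`. -/
theorem exists_integral_pow_le {lam : ℝ} (hlam : 0 < lam) {f : Plane → ℝ}
    (hf : MemLp f (ENNReal.ofReal ((2 * ((q : ℝ) + 1)) / (2 * (q : ℝ) + 1)))
      (volume.restrict Ω)) :
    ∃ B : ℝ, 0 ≤ B ∧ ∀ (W : Submodule ℝ (SobolevH1 Ω)) (U : SobolevH1 Ω),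
      HasPowerIntegrable q U → IsGalerkinSolution lam q f W U →
      ∫ x in Ω, h1Fun U x ^ (2 * (q + 1)) ≤ B := by
  set p' : ℝ := (2 * ((q : ℝ) + 1)) / (2 * (q : ℝ) + 1) with hp'
  set p : ℝ := ((2 * (q + 1) : ℕ) : ℝ) with hp
  have hq0 : (0 : ℝ) ≤ q := Nat.cast_nonneg q
  have hp2 : 2 ≤ p := by
    rw [hp]; push_cast; linarith
  have hp'1 : 1 ≤ p' := by
    rw [hp', le_div_iff₀ (by positivity)]; linarith
  have hconj : p'.HolderConjugate p := by
    rw [Real.holderConjugate_iff_eq_conjExponent (lt_of_le_of_ne hp'1 ?_)]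
    · rw [hp, hp']
      have : (2 * ((q : ℝ) + 1)) / (2 * (q : ℝ) + 1) - 1 = 1 / (2 * q + 1) := by
        field_simp; ring
      rw [this]
      push_cast
      field_simp
    · intro h
      rw [hp', eq_div_iff (by positivity)] at h
      linarith
  -- Young's inequality is applied to (s⁻¹ f)(s U). Since s^p ≤ λ and p ≥ 2, the power of U gets a
  -- coefficient of at most λ/2, which the left side absorbs; this leaves the factor 2/λ in the
  -- bound.
  set s := min 1 lam with hs
  have hs0 : 0 < s := lt_min one_pos hlam
  have hs1 : s ^ (2 * (q + 1)) ≤ lam :=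
    (pow_le_of_le_one hs0.le (min_le_left _ _) (by omega)).trans (min_le_right _ _)
  have hfi : Integrable (fun x => |s⁻¹ * f x| ^ p') (volume.restrict Ω) := by
    have h := (hf.const_mul s⁻¹).integrable_norm_rpow (by simpa using by linarith) (by simp)
    rwa [ENNReal.toReal_ofReal (by linarith)] at h
  refine ⟨2 / lam * ∫ x in Ω, |s⁻¹ * f x| ^ p', ?_, fun W U hU hsol => ?_⟩
  · exact mul_nonneg (by positivity) (integral_nonneg fun x => by positivity)
  have hpt : ∀ x, |f x * h1Fun U x| ≤
      |s⁻¹ * f x| ^ p' + lam / 2 * h1Fun U x ^ (2 * (q + 1)) := by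
    intro x
    have h1 := Real.young_inequality_of_nonneg (abs_nonneg (s⁻¹ * f x))
      (abs_nonneg (s * h1Fun U x)) hconj
    rw [← abs_mul] at h1
    have e1 : s⁻¹ * f x * (s * h1Fun U x) = f x * h1Fun U x := by field_simp
    rw [e1, hp, Real.rpow_natCast, (even_two_mul (q + 1)).pow_abs, mul_pow, ← hp] at h1
    refine h1.trans (add_le_add (div_le_self (by positivity) hp'1) ?_)
    have hpos : 0 ≤ h1Fun U x ^ (2 * (q + 1)) := (even_two_mul _).pow_nonneg _
    calc _ ≤ lam * h1Fun U x ^ (2 * (q + 1)) / 2 := by gcongr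
      _ = _ := by ring
  have hI : Integrable (fun x => |s⁻¹ * f x| ^ p' + lam / 2 * h1Fun U x ^ (2 * (q + 1)))
      (volume.restrict Ω) := hfi.add (Integrable.const_mul hU _)
  have hfU : Integrable (fun x => f x * h1Fun U x) (volume.restrict Ω) :=
    hI.mono' (hf.1.mul (Lp.aestronglyMeasurable (h1Fun U))) (Eventually.of_forall hpt)
  have h2 : ∫ x in Ω, f x * h1Fun U x ≤
      (∫ x in Ω, |s⁻¹ * f x| ^ p') + lam / 2 * ∫ x in Ω, h1Fun U x ^ (2 * (q + 1)) := by
    rw [← integral_const_mul, ← integral_add hfi (Integrable.const_mul hU _)]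
    exact integral_mono hfU hI fun x => (le_abs_self _).trans (hpt x)
  have h3 := hsol.2 U hsol.1
  have h4 : formB q U U = ∫ x in Ω, h1Fun U x ^ (2 * (q + 1)) := by
    rw [formB]
    congr 1
  have h5 : 0 ≤ formA U U := by
    rw [formA_eq_inner]
    exact real_inner_self_nonneg
  rw [h4] at h3
  rw [div_mul_eq_mul_div, le_div_iff₀ hlam]
  linarith

theorem le_of_sq_le_mul_add {E s A : ℝ} (hs : 0 < s) (hA : 0 ≤ A)
    (h : E ^ 2 ≤ E * s + A * s ^ 2) : E ≤ (1 + A) * s := by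
  by_contra! hlt
  have h1 : A * s < E - s := by linarith
  have h2 : s < E := by nlinarith
  nlinarith [mul_nonneg hA hs.le, mul_pos hs (sub_pos.2 h1)]

/-- Galerkin orthogonality with the test function w - U, combined with the pointwise bound
`neg_odd_pow_sub_mul_le` for the nonlinear part. -/
theorem IsGalerkinSolution.sq_gradNorm_le {lam : ℝ} (hlam : 0 < lam) {f : Plane → ℝ}
    {V W : Submodule ℝ (SobolevH1 Ω)} (hWV : W ≤ V) (hV : ∀ v ∈ V, HasPowerIntegrable q v)
    {u U w : SobolevH1 Ω} (hu : IsGalerkinSolution lam q f V u)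
    (hU : IsGalerkinSolution lam q f W U) (hw : w ∈ W) :
    gradNorm (u - U) ^ 2 ≤ gradNorm (u - U) * gradNorm (u - w) +
      lam * (2 * q + 1) ^ 2 * ((∫ x in Ω, h1Fun u x ^ (2 * q) * h1Fun (u - w) x ^ 2) +
        ∫ x in Ω, h1Fun U x ^ (2 * q) * h1Fun (u - w) x ^ 2) := by
  have hv : w - U ∈ W := W.sub_mem hw hU.1
  have hui := hV u hu.1
  have hUi := hV U (hWV hU.1)
  have hvi := hV _ (hWV hv)
  have hηi := hV _ (V.sub_mem hu.1 (hWV hw))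
  have h1 := hu.2 _ (hWV hv)
  have h2 := hU.2 _ hv
  have hB : -(formB q u (w - U) - formB q U (w - U)) ≤
      (2 * q + 1) ^ 2 * ((∫ x in Ω, h1Fun u x ^ (2 * q) * h1Fun (u - w) x ^ 2) +
        ∫ x in Ω, h1Fun U x ^ (2 * q) * h1Fun (u - w) x ^ 2) := by
    have i1 := hui.integrable_pow_mul_pow hηi (by ring : 2 * q + 2 = 2 * (q + 1))
    have i2 := hUi.integrable_pow_mul_pow hηi (by ring : 2 * q + 2 = 2 * (q + 1))
    rw [formB, formB, ← integral_sub (hui.integrable_formB hvi) (hUi.integrable_formB hvi),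
      ← integral_neg, ← integral_add i1 i2, ← integral_const_mul]
    refine integral_mono_ae
      ((hui.integrable_formB hvi).sub (hUi.integrable_formB hvi)).neg
      ((i1.add i2).const_mul _) ?_
    filter_upwards [h1Fun_sub_ae w U, h1Fun_sub_ae u w] with x hx1 hx2
    have h := neg_odd_pow_sub_mul_le (h1Fun u x) (h1Fun U x) (h1Fun w x) q
    simp only [hx1, hx2]
    rw [← sub_mul, ← add_mul]
    exact h
  have hA : formA u (w - U) - formA U (w - U) =
      inner ℝ (h1Grad (u - U)) (h1Grad (u - U)) - inner ℝ (h1Grad (u - U)) (h1Grad (u - w)) := by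
    rw [formA_eq_inner, formA_eq_inner, ← inner_sub_left, ← inner_sub_right]
    congr 1
    change h1Grad w - h1Grad U = (h1Grad u - h1Grad U) - (h1Grad u - h1Grad w)
    abel
  rw [real_inner_self_eq_norm_sq] at hA
  have hcs : inner ℝ (h1Grad (u - U)) (h1Grad (u - w)) ≤
      gradNorm (u - U) * gradNorm (u - w) := real_inner_le_norm _ _
  have hB' := mul_le_mul_of_nonneg_left hB hlam.le
  change gradNorm (u - U) ^ 2 ≤ _
  have hg : ‖h1Grad (u - U)‖ = gradNorm (u - U) := rfl
  rw [hg] at hA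
  linarith

end QuasiOptimality

theorem proposition3p2 {m : ℕ} [NeZero m] (Ω : Set Plane) (c : Fin m → Plane)
    (hΩ : IsPolygonalDomain Ω c) (lam : ℝ) (hlam : 0 < lam) (q : ℕ) (f : Plane → ℝ)
    (hf : MemLp f (ENNReal.ofReal ((2 * ((q : ℝ) + 1)) / (2 * (q : ℝ) + 1)))
      (volume.restrict Ω)) :
    ∃ C : ℝ, 0 < C ∧
      ∀ D : Finset (Fin m), D.Nonempty →
      ∀ u : SobolevH1 Ω, IsGalerkinSolution lam q f (SobolevH1D Ω c D) u →
      ∀ W : Submodule ℝ (SobolevH1 Ω), W ≤ SobolevH1D Ω c D → FiniteDimensional ℝ W →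
      ∀ U : SobolevH1 Ω, IsGalerkinSolution lam q f W U →
        gradNorm (u - U) ≤ C * ⨅ w : W, gradNorm (u - (w : SobolevH1 Ω)) := by
  obtain ⟨K, hK, hS⟩ := hΩ.exists_sobolev_friedrichs (q + 1)
  obtain ⟨B, hB, hap⟩ := exists_integral_pow_le (q := q) hlam hf
  -- The two weights u^{2q} and U^{2q} contribute B + K each.
  set A : ℝ := lam * (2 * q + 1) ^ 2 * (2 * (B + K)) with hA
  have hA0 : 0 ≤ A := by positivity
  refine ⟨1 + A, by positivity, fun D hD u hu W hW _ U hU => ?_⟩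
  rw [Real.mul_iInf_of_nonneg (by positivity)]
  refine le_ciInf fun ⟨w, hw⟩ => ?_
  have hV : ∀ v ∈ SobolevH1D Ω c D, HasPowerIntegrable q v := fun v hv => (hS D hD v hv).1
  have hηV : u - w ∈ SobolevH1D Ω c D := Submodule.sub_mem _ hu.1 (hW hw)
  have hui := hV u hu.1
  have hUi := hV U (hW hU.1)
  have hmain := hu.sq_gradNorm_le hlam hW hV hU hw
  change gradNorm (u - U) ≤ (1 + A) * gradNorm (u - w)
  rw [← div_le_iff₀' (by positivity)]
  -- The scaling argument divides by s, whereas ‖∇(u - w)‖ may vanish; hence the bound is proved for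
  -- every larger s.
  refine le_of_forall_gt_imp_ge_of_dense fun s hs => ?_
  have hg0 : 0 ≤ gradNorm (u - w) := norm_nonneg _
  have hs0 : 0 < s := hg0.trans_lt hs
  rw [div_le_iff₀' (by positivity)]
  refine le_of_sq_le_mul_add hs0 hA0 (hmain.trans ?_)
  have hηs : (∫ x in Ω, h1Fun (u - w) x ^ (2 * (q + 1))) / s ^ (2 * (q + 1)) ≤ K := by
    rw [div_le_iff₀ (by positivity)]
    refine (hS D hD _ hηV).2.trans ?_
    gcongr
  have hweight : ∀ v : SobolevH1 Ω, HasPowerIntegrable q v →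
      ∫ x in Ω, h1Fun v x ^ (2 * (q + 1)) ≤ B →
      ∫ x in Ω, h1Fun v x ^ (2 * q) * h1Fun (u - w) x ^ 2 ≤ s ^ 2 * (B + K) := by
    intro v hv hvB
    refine (integral_pow_mul_sq_le hv (hV _ hηV) hs0).trans ?_
    gcongr
  -- The weak solution is the Galerkin solution for the full space, so the same a priori bound
  -- applies to it.
  have h1 := hweight u hui (hap _ u hui hu)
  have h2 := hweight U hUi (hap _ U hUi hU)
  have hE : 0 ≤ gradNorm (u - U) := norm_nonneg _
  calc _ ≤ gradNorm (u - U) * s +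
        lam * (2 * q + 1) ^ 2 * (s ^ 2 * (B + K) + s ^ 2 * (B + K)) := by gcongr
    _ = _ := by rw [hA]; ring
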